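/- Let $n\ge 1$, let $\mathcal C$ be an additive category and $\mathbb E\colon \mathcal C^{\mathrm{op}}\times\mathcal C\to \mathrm{Ab}$ an additive bifunctor. For $\delta\in\mathbb E(C,A)$, $a\colon A\to A'$ and $c\colon C'\to C$ write $a_*\delta=\mathbb E(C,a)(\delta)$ and $c^*\delta=\mathbb E(c,A)(\delta)$. For $A,C\in\mathcal C$ consider the complexes $X_\bullet\colon A=X_0\xrightarrow{d_0}X_1\to\cdots\to X_n\xrightarrow{d_n}X_{n+1}=C$ in $\mathcal C$, with morphisms of complexes that are the identity on $A$ and $C$, and let $[X_\bullet]$ be the homotopy equivalence class of $X_\bullet$ in this category. Let $\mathfrak s$ assign to each $\delta\in\mathbb E(C,A)$ such a class $\mathfrak s(\delta)$; if $\mathfrak s(\delta)=[X_\bullet]$ we say that $X_\bullet$ realizes $\delta$. A morphism $f$ is an inflation (respectively a deflation) if $f=d_0$ (respectively $f=d_n$) for some complex $X_\bullet$ realizing some extension. The triple $(\mathcal C,\mathbb E,\mathfrak s)$ is an $n$-exangulated category (Herschend–Liu–Nakaoka) if: - (R0) whenever $X_\bullet$ realizes $\delta\in\mathbb E(C,A)$,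 $Y_\bullet$ realizes $\rho\in\mathbb E(C',A')$, and $a\colon A\to A'$, $c\colon C\to C'$ satisfy $a_*\delta=c^*\rho$, there is a morphism of complexes $(a,f_1,\dots,f_n,c)\colon X_\bullet\to Y_\bullet$; - (R1) whenever $X_\bullet$ realizes $\delta\in\mathbb E(C,A)$, one has $(d_0)_*\delta=0$ and $(d_n)^*\delta=0$, and the sequences of functors $\mathcal C(-,X_0)\to\cdots\to\mathcal C(-,X_{n+1})\xrightarrow{f\mapsto f^*\delta}\mathbb E(-,A)$ and $\mathcal C(X_{n+1},-)\to\cdots\to\mathcal C(X_0,-)\xrightarrow{g\mapsto g_*\delta}\mathbb E(C,-)$ are exact; - (R2) $A\xrightarrow{1}A\to0\to\cdots\to0$ realizes $0\in\mathbb E(0,A)$, and $0\to\cdots\to0\to A\xrightarrow{1}A$ realizes $0\in\mathbb E(A,0)$, for every $A\in\mathcal C$; - (EA1) inflations are closed under composition, and so are deflations; - (EA2) if $\rho\in\mathbb E(D,A)$, $c\colon C\to D$, $X_\bullet$ realizes $c^*\rho$ and $Y_\bullet$ realizes $\rho$, then there is a morphism of complexes $f_\bullet=(1_A,f_1,\dots,f_n,c)\colon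 X_\bullet\to Y_\bullet$ whose mapping cone $X_1\to X_2\oplus Y_1\to\cdots\to X_{n+1}\oplus Y_n\to Y_{n+1}$ realizes $(d_0^X)_*\rho$; - (EA2$^{\mathrm{op}}$) the dual of (EA2): if $\delta\in\mathbb E(C,A)$, $a\colon A\to A'$, $X_\bullet$ realizes $\delta$ and $Y_\bullet$ realizes $a_*\delta$, then there is a morphism of complexes $f_\bullet=(a,f_1,\dots,f_n,1_C)\colon X_\bullet\to Y_\bullet$ whose mapping cocone $X_0\to X_1\oplus Y_0\to\cdots\to X_n\oplus Y_{n-1}\to Y_n$ realizes $(d_n^Y)^*\delta$. **Theorem.** Let $(\mathcal C,\mathbb E,\mathfrak s)$ be an $n$-exangulated category such that $\mathcal C$ is Krull–Schmidt (every object is a finite direct sum of objects with local endomorphism rings). Let $\mathcal A\subseteq\mathcal C$ be a full subcategory closed under isomorphisms, finite direct sums (including the zero object) and direct summands, which is $n$-extension closed: for all $A,C\in\mathcal A$, every $\delta\in\mathbb E(C,A)$ is realized by some complex $X_\bullet$ with $X_1,\dots,X_n\in\mathcal A$. Let $\mathbb E_{\mathcal A}$ be the restriction of $\mathbb E$ to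 $\mathcal A^{\mathrm{op}}\times\mathcal A$, and for $\delta\in\mathbb E_{\mathcal A}(C,A)$ let $\mathfrak t(\delta)$ be the homotopy equivalence class, formed in $\mathcal A$, of a complex $X_\bullet$ with $X_1,\dots,X_n\in\mathcal A$ which realizes $\delta$ in $\mathcal C$. Then $\mathfrak t$ is well defined (a complex $X_\bullet$ in $\mathcal A$ with end terms $A,C$ satisfies $\mathfrak t(\delta)=[X_\bullet]$ in $\mathcal A$ if and only if $\mathfrak s(\delta)=[X_\bullet]$ in $\mathcal C$), and $(\mathcal A,\mathbb E_{\mathcal A},\mathfrak t)$ is an $n$-exangulated category. -/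

import Mathlib

open CategoryTheory CategoryTheory.Limits Opposite

universe w v u

namespace NExangulated

section Basic

variable {C : Type u} [Category.{v} C]

/-- `Ext E B A` is the group `𝔼(B, A)` of extensions, for a bifunctor `E : Cᵒᵖ × C → Ab`
(given in curried form). -/
abbrev Ext (E : Cᵒᵖ ⥤ C ⥤ AddCommGrpCat.{w}) (B A : C) : Type w :=
  ((E.obj (op B)).obj A : AddCommGrpCat.{w})

/-- The push-forward `a_* δ = 𝔼(B, a)(δ)`. -/
def push (E : Cᵒᵖ ⥤ C ⥤ AddCommGrpCat.{w}) {A A' B : C} (a : A ⟶ A') (δ : Ext E B A) :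
    Ext E B A' :=
  ((E.obj (op B)).map a).hom δ

/-- The pull-back `c^* δ = 𝔼(c, A)(δ)`. -/
def pull (E : Cᵒᵖ ⥤ C ⥤ AddCommGrpCat.{w}) {A B B' : C} (c : B' ⟶ B) (δ : Ext E B A) :
    Ext E B' A :=
  ((E.map c.op).app A).hom δ

/-- The shape of a finite complex `X₀ ⟶ X₁ ⟶ ⋯ ⟶ Xₙ₊₁`: indices `0, …, n+1`, with a
differential from `i` to `i + 1`. -/
def shape (n : ℕ) : ComplexShape (Fin (n + 2)) where
  Rel i j := (i : ℕ) + 1 = j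
  next_eq h h' := Fin.ext (h.symm.trans h')
  prev_eq h h' := Fin.ext (Nat.succ_injective (h.trans h'.symm))

/-- The index `1` among `0, …, n+1`. -/
abbrev one (n : ℕ) : Fin (n + 2) := ⟨1, by omega⟩

/-- The index `n` among `0, …, n+1`. -/
abbrev pen (n : ℕ) : Fin (n + 2) := ⟨n, by omega⟩

/-- The index `n + 1` among `0, …, n+1`. -/
abbrev top (n : ℕ) : Fin (n + 2) := ⟨n + 1, by omega⟩

end Basic

section Complexes

variable {C : Type u} [Category.{v} C] [Preadditive C]

/-- A complex `X₀ ⟶ X₁ ⟶ ⋯ ⟶ Xₙ₊₁` whose end terms are identified with `A` and `B`. -/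
structure EndedComplex (n : ℕ) (A B : C) where
  /-- the complex -/
  cpx : HomologicalComplex C (shape n)
  /-- the identification of the first term -/
  source : cpx.X 0 ≅ A
  /-- the identification of the last term -/
  target : cpx.X (top n) ≅ B

namespace EndedComplex

variable {n : ℕ} {A B : C}

/-- The first differential, as a morphism `A ⟶ X₁`. -/
def inc (X : EndedComplex n A B) : A ⟶ X.cpx.X (one n) :=
  X.source.inv ≫ X.cpx.d 0 (one n)

/-- The last differential, as a morphism `Xₙ ⟶ B`. -/
def proj (X : EndedComplex n A B) : X.cpx.X (pen n) ⟶ B :=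
  X.cpx.d (pen n) (top n) ≫ X.target.hom

/-- A morphism of complexes is of the form `(a, f₁, …, fₙ, c)`. -/
def IsLift {A' B' : C} {X : EndedComplex n A B} {Y : EndedComplex n A' B'}
    (f : X.cpx ⟶ Y.cpx) (a : A ⟶ A') (c : B ⟶ B') : Prop :=
  f.f 0 ≫ Y.source.hom = X.source.hom ≫ a ∧
    f.f (top n) ≫ Y.target.hom = X.target.hom ≫ c

/-- Homotopy equivalence in the category of complexes with end terms `A` and `B`: the
morphisms in that category are the morphisms of complexes `(𝟙 A, f₁, …, fₙ, 𝟙 B)`, and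
homotopies are those of complexes. -/
def Equivalent (X Y : EndedComplex n A B) : Prop :=
  ∃ e : HomotopyEquiv X.cpx Y.cpx,
    IsLift (X := X) (Y := Y) e.hom (𝟙 A) (𝟙 B) ∧ IsLift (X := Y) (Y := X) e.inv (𝟙 A) (𝟙 B)

theorem equivalent_equivalence :
    Equivalence (Equivalent : EndedComplex n A B → EndedComplex n A B → Prop) where
  refl X := ⟨HomotopyEquiv.refl _, by simp [IsLift], by simp [IsLift]⟩
  symm := fun ⟨e, h, h'⟩ => ⟨e.symm, h', h⟩
  trans := fun {X Y Z} ⟨e, h, h'⟩ ⟨e', k, k'⟩ =>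
    ⟨e.trans e', by simp_all [IsLift], by simp_all [IsLift]⟩

/-- Complexes from `A` to `B` up to homotopy equivalence. -/
instance setoid (n : ℕ) (A B : C) : Setoid (EndedComplex n A B) :=
  ⟨Equivalent, equivalent_equivalence⟩

end EndedComplex

/-- A correspondence which associates to each extension `δ ∈ 𝔼(B, A)` a homotopy equivalence
class of complexes with end terms `A` and `B`. -/
abbrev Correspondence (n : ℕ) (E : Cᵒᵖ ⥤ C ⥤ AddCommGrpCat.{w}) :=
  ∀ ⦃A B : C⦄, Ext E B A → Quotient (EndedComplex.setoid n A B)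

/-- `s(δ) = [X]`. -/
def Realizes {n : ℕ} {E : Cᵒᵖ ⥤ C ⥤ AddCommGrpCat.{w}} (s : Correspondence n E) {A B : C}
    (δ : Ext E B A) (X : EndedComplex n A B) : Prop :=
  s δ = Quotient.mk _ X

/-- `⟨X, δ⟩` is an `n`-exangle: `(d₀)_* δ = 0`, `(dₙ)^* δ = 0`, and the sequences
`C(-, X₀) ⟶ ⋯ ⟶ C(-, Xₙ₊₁) ⟶ 𝔼(-, X₀)` and
`C(Xₙ₊₁, -) ⟶ ⋯ ⟶ C(X₀, -) ⟶ 𝔼(Xₙ₊₁, -)` are exact. -/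
structure IsExangle {n : ℕ} (E : Cᵒᵖ ⥤ C ⥤ AddCommGrpCat.{w}) {A B : C}
    (X : EndedComplex n A B) (δ : Ext E B A) : Prop where
  push_inc : push E X.inc δ = 0
  pull_proj : pull E X.proj δ = 0
  exact_to (T : C) (i j k : Fin (n + 2)) (hij : (shape n).Rel i j) (hjk : (shape n).Rel j k) :
    Function.Exact (fun g : T ⟶ X.cpx.X i => g ≫ X.cpx.d i j)
      (fun g : T ⟶ X.cpx.X j => g ≫ X.cpx.d j k)
  exact_to_last (T : C) :
    Function.Exact (fun g : T ⟶ X.cpx.X (pen n) => g ≫ X.proj)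
      (fun g : T ⟶ B => pull E g δ)
  exact_from (T : C) (i j k : Fin (n + 2)) (hij : (shape n).Rel i j)
    (hjk : (shape n).Rel j k) :
    Function.Exact (fun g : X.cpx.X k ⟶ T => X.cpx.d j k ≫ g)
      (fun g : X.cpx.X j ⟶ T => X.cpx.d i j ≫ g)
  exact_from_first (T : C) :
    Function.Exact (fun g : X.cpx.X (one n) ⟶ T => X.inc ≫ g)
      (fun g : A ⟶ T => push E g δ)

/-- `s` is an exact realization of `𝔼`. -/
structure IsExactRealization {n : ℕ} (E : Cᵒᵖ ⥤ C ⥤ AddCommGrpCat.{w})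
    (s : Correspondence n E) : Prop where
  /-- (R0) morphisms of extensions lift to morphisms of complexes -/
  lift {A B A' B' : C} (δ : Ext E B A) (ρ : Ext E B' A')
    (X : EndedComplex n A B) (Y : EndedComplex n A' B')
    (hX : Realizes s δ X) (hY : Realizes s ρ Y)
    (a : A ⟶ A') (c : B ⟶ B') (h : push E a δ = pull E c ρ) :
    ∃ f : X.cpx ⟶ Y.cpx, EndedComplex.IsLift f a c
  /-- (R1) realizing complexes are `n`-exangles -/
  exangle {A B : C} (δ : Ext E B A) (X : EndedComplex n A B) (hX : Realizes s δ X) :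
    IsExangle E X δ
  /-- (R2) `A = A ⟶ 0 ⟶ ⋯ ⟶ 0` realizes `0 ∈ 𝔼(0, A)` -/
  zero_right {A B : C} (X : EndedComplex n A B) (h : IsIso (X.cpx.d 0 (one n)))
    (h0 : ∀ i : Fin (n + 2), 2 ≤ (i : ℕ) → IsZero (X.cpx.X i)) :
    Realizes s (0 : Ext E B A) X
  /-- (R2), dual: `0 ⟶ ⋯ ⟶ 0 ⟶ B = B` realizes `0 ∈ 𝔼(B, 0)` -/
  zero_left {A B : C} (X : EndedComplex n A B) (h : IsIso (X.cpx.d (pen n) (top n)))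
    (h0 : ∀ i : Fin (n + 2), (i : ℕ) < n → IsZero (X.cpx.X i)) :
    Realizes s (0 : Ext E B A) X

/-- An inflation is, up to isomorphism of arrows, the first differential of a complex
realizing some extension. (For an exact realization, such complexes are closed under
isomorphisms, so that this is the same as being equal to such a differential.) -/
def IsInflation {n : ℕ} {E : Cᵒᵖ ⥤ C ⥤ AddCommGrpCat.{w}} (s : Correspondence n E)
    {U V : C} (f : U ⟶ V) : Prop :=
  ∃ (A B : C) (δ : Ext E B A) (X : EndedComplex n A B), Realizes s δ X ∧
    Nonempty (Arrow.mk f ≅ Arrow.mk (X.cpx.d 0 (one n)))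

/-- A deflation is, up to isomorphism of arrows, the last differential of a complex
realizing some extension. -/
def IsDeflation {n : ℕ} {E : Cᵒᵖ ⥤ C ⥤ AddCommGrpCat.{w}} (s : Correspondence n E)
    {U V : C} (f : U ⟶ V) : Prop :=
  ∃ (A B : C) (δ : Ext E B A) (X : EndedComplex n A B), Realizes s δ X ∧
    Nonempty (Arrow.mk f ≅ Arrow.mk (X.cpx.d (pen n) (top n)))

/-- Data which make `M` the mapping cone of a morphism `f : X ⟶ Y` with `f₀ = 𝟙`:
`X₁ ⟶ X₂ ⊕ Y₁ ⟶ ⋯ ⟶ Xₙ₊₁ ⊕ Yₙ ⟶ Yₙ₊₁`,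
with first differential `(-d₁, f₁)`, last differential `(fₙ₊₁, dₙ)`, and the differential
`Xᵢ₊₁ ⊕ Yᵢ ⟶ Xᵢ₊₂ ⊕ Yᵢ₊₁` given by `(x, y) ↦ (-d x, f x + d y)`.
The projections of `Mᵢ` are `fst i (i+1) : Mᵢ ⟶ Xᵢ₊₁` and `snd i : Mᵢ ⟶ Yᵢ`. -/
structure MappingConeData {n : ℕ} {A B D : C} {X : EndedComplex n A B}
    {Y : EndedComplex n A D} (f : X.cpx ⟶ Y.cpx)
    (M : EndedComplex n (X.cpx.X (one n)) D) where
  fst (i j : Fin (n + 2)) : M.cpx.X i ⟶ X.cpx.X j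
  snd (i : Fin (n + 2)) : M.cpx.X i ⟶ Y.cpx.X i
  fst_first : fst 0 (one n) = M.source.hom
  snd_first : snd 0 = 0
  snd_last : snd (top n) = M.target.hom ≫ Y.target.inv
  isProduct (i j : Fin (n + 2)) (hij : (shape n).Rel i j) (hi : i ≠ 0) :
    Nonempty (IsLimit (BinaryFan.mk (fst i j) (snd i)))
  d_fst (i j k : Fin (n + 2)) (hij : (shape n).Rel i j) (hjk : (shape n).Rel j k) :
    M.cpx.d i j ≫ fst j k = -(fst i j ≫ X.cpx.d j k)
  d_snd (i j : Fin (n + 2)) (hij : (shape n).Rel i j) :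
    M.cpx.d i j ≫ snd j = fst i j ≫ f.f j + snd i ≫ Y.cpx.d i j

/-- Data which make `N` the mapping cocone (the dual of the mapping cone) of a morphism
`f : X ⟶ Y` with `fₙ₊₁ = 𝟙`:
`X₀ ⟶ X₁ ⊕ Y₀ ⟶ ⋯ ⟶ Xₙ ⊕ Yₙ₋₁ ⟶ Yₙ`,
with first differential `(d₀, f₀)`, last differential `(fₙ, -dₙ₋₁)`, and the differential
`Xᵢ ⊕ Yᵢ₋₁ ⟶ Xᵢ₊₁ ⊕ Yᵢ` given by `(x, y) ↦ (d x, f x - d y)`.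
The injections into `Nⱼ` are `inl j : Xⱼ ⟶ Nⱼ` and `inr (j-1) j : Yⱼ₋₁ ⟶ Nⱼ`. -/
structure MappingCoconeData {n : ℕ} {A A' B : C} {X : EndedComplex n A B}
    {Y : EndedComplex n A' B} (f : X.cpx ⟶ Y.cpx)
    (N : EndedComplex n A (Y.cpx.X (pen n))) where
  inl (j : Fin (n + 2)) : X.cpx.X j ⟶ N.cpx.X j
  inr (i j : Fin (n + 2)) : Y.cpx.X i ⟶ N.cpx.X j
  inr_last : inr (pen n) (top n) = N.target.inv
  inl_last : inl (top n) = 0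
  inl_first : inl 0 = X.source.hom ≫ N.source.inv
  isCoproduct (i j : Fin (n + 2)) (hij : (shape n).Rel i j) (hj : j ≠ top n) :
    Nonempty (IsColimit (BinaryCofan.mk (inl j) (inr i j)))
  inr_d (i j k : Fin (n + 2)) (hij : (shape n).Rel i j) (hjk : (shape n).Rel j k) :
    inr i j ≫ N.cpx.d j k = -(Y.cpx.d i j ≫ inr j k)
  inl_d (i j : Fin (n + 2)) (hij : (shape n).Rel i j) :
    inl i ≫ N.cpx.d i j = X.cpx.d i j ≫ inl j + f.f i ≫ inr i j

/-- `(C, 𝔼, s)` is an `n`-exangulated category: `C` is an additive category, `𝔼` is an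
additive bifunctor, `s` is an exact realization of `𝔼`, and (EA1), (EA2), (EA2ᵒᵖ) hold. -/
structure IsNExangulated {n : ℕ} (E : Cᵒᵖ ⥤ C ⥤ AddCommGrpCat.{w})
    (s : Correspondence n E) : Prop where
  hasFiniteBiproducts : HasFiniteBiproducts C
  additive_right (B : C) : (E.obj (op B)).Additive
  additive_left (A : C) : (E.flip.obj A).Additive
  exactRealization : IsExactRealization E s
  /-- (EA1) inflations compose -/
  inflation_comp {U V W : C} (f : U ⟶ V) (g : V ⟶ W) (hf : IsInflation s f)
    (hg : IsInflation s g) : IsInflation s (f ≫ g)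
  /-- (EA1) deflations compose -/
  deflation_comp {U V W : C} (f : U ⟶ V) (g : V ⟶ W) (hf : IsDeflation s f)
    (hg : IsDeflation s g) : IsDeflation s (f ≫ g)
  /-- (EA2) `(𝟙 A, c)` has a good lift -/
  good_lift {A B D : C} (ρ : Ext E D A) (c : B ⟶ D)
    (X : EndedComplex n A B) (Y : EndedComplex n A D)
    (hX : Realizes s (pull E c ρ) X) (hY : Realizes s ρ Y) :
    ∃ (f : X.cpx ⟶ Y.cpx) (M : EndedComplex n (X.cpx.X (one n)) D),
      EndedComplex.IsLift f (𝟙 A) c ∧ Nonempty (MappingConeData f M) ∧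
        Realizes s (push E X.inc ρ) M
  /-- (EA2ᵒᵖ) `(a, 𝟙 B)` has a good lift -/
  good_lift_op {A A' B : C} (δ : Ext E B A) (a : A ⟶ A')
    (X : EndedComplex n A B) (Y : EndedComplex n A' B)
    (hX : Realizes s δ X) (hY : Realizes s (push E a δ) Y) :
    ∃ (f : X.cpx ⟶ Y.cpx) (N : EndedComplex n A (Y.cpx.X (pen n))),
      EndedComplex.IsLift f a (𝟙 B) ∧ Nonempty (MappingCoconeData f N) ∧
        Realizes s (pull E Y.proj δ) N

end Complexes

section Subcategories

variable {C : Type u} [Category.{v} C] [Preadditive C]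

/-- Every object is a finite direct sum of objects with local endomorphism rings. -/
def IsKrullSchmidt (C : Type u) [Category.{v} C] [Preadditive C] [HasFiniteBiproducts C] :
    Prop :=
  ∀ X : C, ∃ (m : ℕ) (Y : Fin m → C),
    (∀ i, IsLocalRing (End (Y i))) ∧ Nonempty (X ≅ ⨁ Y)

/-- A class of objects which is closed under isomorphisms, finite direct sums (including
the empty one) and direct summands. -/
structure IsAdditiveSubcategory (P : ObjectProperty C) : Prop where
  iso {X Y : C} (e : X ≅ Y) (hX : P X) : P Y
  zero {X : C} (hX : IsZero X) : P X
  sum {X Y : C} (b : BinaryBicone X Y) (hb : b.IsBilimit) (hX : P X) (hY : P Y) : P b.pt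
  summand {X Y : C} (b : BinaryBicone X Y) (hb : b.IsBilimit) (h : P b.pt) : P X

variable {n : ℕ} {E : Cᵒᵖ ⥤ C ⥤ AddCommGrpCat.{w}}

/-- `P` is `n`-extension closed: each extension of objects in `P` is realized by a complex
with all terms in `P`. -/
def IsNExtensionClosed (s : Correspondence n E) (P : ObjectProperty C) : Prop :=
  ∀ ⦃A B : C⦄, P A → P B → ∀ δ : Ext E B A,
    ∃ X : EndedComplex n A B, Realizes s δ X ∧ ∀ i, P (X.cpx.X i)

/-- The restriction of `𝔼` to `Pᵒᵖ × P`. -/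
def restrictBifunctor (E : Cᵒᵖ ⥤ C ⥤ AddCommGrpCat.{w}) (P : ObjectProperty C) :
    P.FullSubcategoryᵒᵖ ⥤ P.FullSubcategory ⥤ AddCommGrpCat.{w} :=
  P.ι.op ⋙ E ⋙ (Functor.whiskeringLeft _ _ _).obj P.ι

/-- A complex in the full subcategory, viewed as a complex in the ambient category. -/
def EndedComplex.toAmbient {P : ObjectProperty C} {A B : P.FullSubcategory}
    (X : EndedComplex n A B) : EndedComplex n A.obj B.obj where
  cpx := (P.ι.mapHomologicalComplex (shape n)).obj X.cpx
  source := P.ι.mapIso X.source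
  target := P.ι.mapIso X.target

/-- A complex with all terms in `P`, viewed as a complex in the full subcategory. -/
def EndedComplex.restrict {P : ObjectProperty C} {A B : P.FullSubcategory}
    (X : EndedComplex n A.obj B.obj) (hX : ∀ i, P (X.cpx.X i)) : EndedComplex n A B where
  cpx :=
    { X := fun i => ⟨X.cpx.X i, hX i⟩
      d := fun i j => ObjectProperty.homMk (X.cpx.d i j)
      shape := fun i j h => ObjectProperty.hom_ext _ (X.cpx.shape i j h)
      d_comp_d' := fun i j k _ _ => ObjectProperty.hom_ext _ (X.cpx.d_comp_d i j k) }
  source := P.isoMk X.source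
  target := P.isoMk X.target

/-- The correspondence `t` on the full subcategory: `t(δ) = [X]`, where `X` is a complex
realizing `δ` in the ambient category and having all its terms in `P`. -/
noncomputable def restrictCorrespondence (s : Correspondence n E) (P : ObjectProperty C)
    (h : IsNExtensionClosed s P) : Correspondence n (restrictBifunctor E P) :=
  fun A B δ => Quotient.mk _
    (EndedComplex.restrict (h A.property B.property δ).choose
      (h A.property B.property δ).choose_spec.2)

end Subcategories

end NExangulated

/-! Since `P` is full, complexes, homotopies and exactness pass between `C` and `P`. The terms of a
mapping cone or cocone of complexes in `P` are sums of objects of `P`. So `t` is well defined, and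
every axiom except (EA1) is inherited directly.

For (EA1), let two composable inflations of `P` be given. Their composite is an inflation of `C`,
the first map of some `Z` realizing `ζ ∈ 𝔼(B, A)`, with `A` and `Z₁` in `P`, but the other terms of
`Z` may lie outside. Two facts repair this. (1) `exists_pull_eq_of_comp`: `ζ = γ^* θ` for some `θ ∈
𝔼(D, A)` with `D` in `P`. It rests on exactness of `C(-, B) ⟶ 𝔼(-, A) ⟶ 𝔼(-, Z₁)`. (2)
`exists_realizes_of_pull_eq`: if `Q` in `P` realizes `θ`, and `S` in `P` realizes the push-forward
of `θ` along `A ⟶ Z₁`, the mapping cocone of a good lift `Q ⟶ S` starts with `A ⟶ Q₁ ⊕ Z₁`. As `A ⟶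
Q₁` factors through `Z₁`, a contractible summand `Q₁ = Q₁` splits off (for `n ≥ 2`), leaving a
complex in `P` that starts with `A ⟶ Z₁`. For `n = 1` one shows instead that `Z` already lies in
`P`. Deflations are treated dually. The Krull–Schmidt hypothesis serves only to split idempotents.
-/

namespace NExangulated

/-! ### Krull–Schmidt categories are idempotent complete. -/

section KrullSchmidt

variable {C : Type u} [Category.{v} C] [Preadditive C]

/-- The idempotent `e` factors as a retraction followed by its section. -/
def SplitsIdempotent {X : C} (e : X ⟶ X) : Prop :=
  ∃ (Q : C) (i : Q ⟶ X) (r : X ⟶ Q), i ≫ r = 𝟙 Q ∧ r ≫ i = e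

/-- Splitting off a summand `Y` of `X` on which the idempotent `e` acts invertibly. -/
theorem splitsIdempotent_of_isIso [HasFiniteBiproducts C] {X Y X' : C}
    (ι : Y ⟶ X) (p : X ⟶ Y) (j₀ : X' ⟶ X) (q : X ⟶ X')
    (hj : j₀ ≫ q = 𝟙 X') (hιq : ι ≫ q = 0)
    (hsum : p ≫ ι + q ≫ j₀ = 𝟙 X)
    (hX' : ∀ e' : X' ⟶ X', e' ≫ e' = e' → SplitsIdempotent e')
    (e : X ⟶ X) (he : e ≫ e = e) (hiso : IsIso (ι ≫ e ≫ p)) :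
    SplitsIdempotent e ∧ SplitsIdempotent (𝟙 X - e) := by
  have := hasBinaryBiproducts_of_finite_biproducts C
  obtain ⟨u, hu, hu'⟩ := hiso
  simp only [Category.assoc] at hu
  -- Shear the complement `j₀` along `ι` so that `e ≫ p` vanishes on it, where `u` inverts `ι ≫ e ≫
  -- p`. This is what makes `j ≫ e ≫ q` idempotent on `X'`.
  obtain ⟨j, hj'⟩ : ∃ j, j = j₀ - j₀ ≫ e ≫ p ≫ u ≫ ι := ⟨_, rfl⟩
  have hjq : j ≫ q = 𝟙 X' := by simp [hj', hj, hιq]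
  have hqj : q ≫ j = 𝟙 X - e ≫ p ≫ u ≫ ι := by
    have h1 : q ≫ j₀ = 𝟙 X - p ≫ ι := eq_sub_of_add_eq' hsum
    have : q ≫ j = q ≫ j₀ - (q ≫ j₀) ≫ e ≫ p ≫ u ≫ ι := by simp [hj']
    rw [this, h1]
    have h2 : p ≫ ι ≫ e ≫ p ≫ u ≫ ι = p ≫ ι := by
      have := congrArg (fun f => p ≫ f ≫ ι) hu
      simpa using this
    simp [h2]
  have hjep : j ≫ e ≫ p = 0 := by
    have h2 : u ≫ ι ≫ e ≫ p = 𝟙 Y := by simpa using hu'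
    simp only [hj', Preadditive.sub_comp, Category.assoc]
    rw [h2, Category.comp_id, sub_self]
  have he' : ∀ {Z : C} (f : X ⟶ Z), e ≫ e ≫ f = e ≫ f := fun f => by
    rw [← Category.assoc, he]
  have hqj' : ∀ {Z : C} (f : X ⟶ Z), q ≫ j ≫ f = f - e ≫ p ≫ u ≫ ι ≫ f := fun f => by
    rw [← Category.assoc, hqj]; simp
  have hjep' : ∀ {Z : C} (f : Y ⟶ Z), j ≫ e ≫ p ≫ f = 0 := fun f => by
    have := congrArg (fun g => g ≫ f) hjep
    simpa using this
  have hu3 : ∀ {Z : C} (f : Y ⟶ Z), u ≫ ι ≫ e ≫ p ≫ f = f := fun f => by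
    have := congrArg (fun g => g ≫ f) hu'
    simpa using this
  constructor
  · obtain ⟨Q, a, b, hab, hba⟩ := hX' (j ≫ e ≫ q) (by
      simp only [Category.assoc, hqj', Preadditive.comp_sub, he', hjep', sub_zero])
    have hba' : ∀ {Z : C} (f : X' ⟶ Z), b ≫ a ≫ f = j ≫ e ≫ q ≫ f := fun f => by
      rw [← Category.assoc, hba]; simp
    have hb : j ≫ e ≫ q ≫ b = b := by rw [← hba', hab, Category.comp_id]
    have ha : ∀ {Z : C} (f : X' ⟶ Z), a ≫ j ≫ e ≫ q ≫ f = a ≫ f := fun f => by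
      rw [← hba', ← Category.assoc a b, hab, Category.id_comp]
    -- The image of `e` is a copy of `Y`, embedded by `u ≫ ι ≫ e`, plus the image of the smaller
    -- idempotent.
    refine ⟨Y ⊞ Q, biprod.desc (u ≫ ι ≫ e) (a ≫ j ≫ e), biprod.lift (e ≫ p) (q ≫ b), ?_, ?_⟩
    · have h1 : u ≫ ι ≫ e ≫ q ≫ b = 0 := by
        rw [← hb]
        simp only [hqj', Preadditive.comp_sub, hu3, he']
        simp
      have h2 : a ≫ j ≫ e ≫ q ≫ b = 𝟙 Q := by rw [ha, hab]
      apply biprod.hom_ext' <;> apply biprod.hom_ext <;>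
        simp [he', hjep, h1, h2, hu']
    · simp only [biprod.lift_desc, Category.assoc, hba', hqj']
      simp [he, he', hu3]
  · obtain ⟨Q, a, b, hab, hba⟩ := hX' (𝟙 X' - j ≫ e ≫ q) (by
      simp only [Preadditive.sub_comp, Preadditive.comp_sub, Category.comp_id, Category.id_comp,
        Category.assoc, hqj', he', hjep', sub_zero, sub_self])
    have hba' : ∀ {Z : C} (f : X' ⟶ Z), b ≫ a ≫ f = f - j ≫ e ≫ q ≫ f := fun f => by
      rw [← Category.assoc, hba]; simp
    -- The correction term in `hqj` begins with `e`, which `𝟙 X - e` kills; so `𝟙 X - e` factors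
    -- through `X'` and `Y` does not contribute to its image.
    have h6 : (𝟙 X - e) ≫ q ≫ j = 𝟙 X - e := by
      rw [hqj]; simp [he']
    have h6' : ∀ {Z : C} (f : X ⟶ Z), (𝟙 X - e) ≫ q ≫ j ≫ f = (𝟙 X - e) ≫ f := fun f => by
      rw [← Category.assoc q, ← Category.assoc (𝟙 X - e), h6]
    refine ⟨Q, a ≫ j, (𝟙 X - e) ≫ q ≫ b, ?_, ?_⟩
    · have h7 : j ≫ (𝟙 X - e) ≫ q = b ≫ a := by rw [hba]; simp [hjq]
      have h8 : j ≫ (𝟙 X - e) ≫ q ≫ b = b ≫ a ≫ b := by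
        have := congrArg (fun f => f ≫ b) h7
        simpa using this
      rw [Category.assoc, h8, hab, Category.comp_id, hab]
    · have h9 : (𝟙 X - e) ≫ q ≫ j ≫ e = 0 := by rw [h6']; simp [he]
      have h9' : ∀ {Z : C} (f : X ⟶ Z), (𝟙 X - e) ≫ q ≫ j ≫ e ≫ f = 0 := fun f => by
        have := congrArg (fun g => g ≫ f) h9
        simpa only [Category.assoc, zero_comp] using this
      simp only [Category.assoc, hba']
      rw [Preadditive.comp_sub, Preadditive.comp_sub, h6, h9', sub_zero]

theorem splitsIdempotent_biproduct [HasFiniteBiproducts C] {m : ℕ} (Y : Fin m → C)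
    (hY : ∀ i, IsLocalRing (End (Y i))) (X : C) (f : X ≅ ⨁ Y) (e : X ⟶ X) (he : e ≫ e = e) :
    SplitsIdempotent e := by
  induction m generalizing X with
  | zero =>
    refine ⟨X, 𝟙 X, 𝟙 X, by simp, (IsZero.of_iso ?_ f).eq_of_src _ _⟩
    rw [IsZero.iff_id_eq_zero]
    ext i
    exact i.elim0
  | succ m ih =>
    let Y' : Fin m → C := fun i => Y i.succ
    let ι : Y 0 ⟶ X := biproduct.ι Y 0 ≫ f.inv
    let p : X ⟶ Y 0 := f.hom ≫ biproduct.π Y 0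
    let j : ⨁ Y' ⟶ X := biproduct.desc (fun i => biproduct.ι Y i.succ) ≫ f.inv
    let q : X ⟶ ⨁ Y' := f.hom ≫ biproduct.lift (fun i => biproduct.π Y i.succ)
    have hp : ι ≫ p = 𝟙 _ := by simp [ι, p]
    have hj : j ≫ q = 𝟙 _ := by
      ext a b
      by_cases h : a = b
      · subst h; simp [j, q, Y']
      · have h' : b.succ ≠ a.succ := fun h' => h (Fin.succ_injective _ h').symm
        simp [j, q, Y', biproduct.ι_π_ne _ h', biproduct.ι_π_ne _ (Ne.symm h)]
    have hιq : ι ≫ q = 0 := by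
      ext b
      simp [ι, q, biproduct.ι_π_ne _ (Fin.succ_ne_zero b).symm]
    have hsum : p ≫ ι + q ≫ j = 𝟙 X := by
      rw [← cancel_epi f.inv, ← cancel_mono f.hom]
      have h := biproduct.total (f := Y)
      rw [Fin.sum_univ_succ] at h
      simp only [p, ι, q, j, Preadditive.comp_add, Preadditive.add_comp, Category.assoc,
        Iso.inv_hom_id_assoc, Iso.inv_hom_id, Category.comp_id]
      rw [biproduct.lift_desc, h]
    have hX' : ∀ e' : ⨁ Y' ⟶ ⨁ Y', e' ≫ e' = e' → SplitsIdempotent e' := fun e' he' =>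
      ih Y' (fun i => hY i.succ) (⨁ Y') (Iso.refl _) e' he'
    have hlocal := hY 0
    have hone : ι ≫ e ≫ p + ι ≫ (𝟙 X - e) ≫ p = 𝟙 (Y 0) := by
      simp [hp]
    -- The `Y 0`-entries of `e` and `𝟙 X - e` add up to the identity, so one of them is invertible.
    -- Either case must split `e`, hence the two-fold conclusion of `splitsIdempotent_of_isIso`.
    rcases IsLocalRing.isUnit_or_isUnit_of_add_one (R := End (Y 0)) hone with h | h
    · exact (splitsIdempotent_of_isIso ι p j q hj hιq hsum hX' e he
        ((isUnit_iff_isIso _).1 h)).1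
    · have := (splitsIdempotent_of_isIso ι p j q hj hιq hsum hX' (𝟙 X - e) (by simp [he])
        ((isUnit_iff_isIso _).1 h)).2
      rwa [sub_sub_cancel] at this

theorem IsKrullSchmidt.isIdempotentComplete [HasFiniteBiproducts C] (h : IsKrullSchmidt C) :
    IsIdempotentComplete C where
  idempotents_split X e he := by
    obtain ⟨m, Y, hY, ⟨f⟩⟩ := h X
    exact splitsIdempotent_biproduct Y hY X f e he

/-- Closure under summands requires a complement; it is obtained by splitting the complementary
idempotent. -/
theorem IsAdditiveSubcategory.of_retract [IsIdempotentComplete C]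
    {P : ObjectProperty C} (hP : IsAdditiveSubcategory P) {X Y : C} (r : Retract X Y)
    (hY : P Y) : P X := by
  obtain ⟨Z, i, q, hi, hq⟩ := IsIdempotentComplete.idempotents_split Y (𝟙 Y - r.r ≫ r.i)
    (by simp)
  have h1 : r.i ≫ q = 0 := by
    have : r.i ≫ q ≫ i = 0 := by rw [hq]; simp
    have h2 := congrArg (fun f => f ≫ q) this
    simpa only [Category.assoc, hi, Category.comp_id, zero_comp] using h2
  have h2 : i ≫ r.r = 0 := by
    have : (q ≫ i) ≫ r.r = 0 := by rw [hq]; simp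
    have h2 := congrArg (fun f => i ≫ f) this
    simpa only [Category.assoc, reassoc_of% hi, comp_zero] using h2
  let b : BinaryBicone X Z :=
    { pt := Y, fst := r.r, snd := q, inl := r.i, inr := i
      inl_fst := r.retract, inl_snd := h1, inr_fst := h2, inr_snd := hi }
  exact hP.summand b (isBinaryBilimitOfTotal b (by simp [b, hq])) hY

theorem IsAdditiveSubcategory.biprod [HasBinaryBiproducts C] {P : ObjectProperty C}
    (hP : IsAdditiveSubcategory P) {X Y : C} (hX : P X) (hY : P Y) : P (X ⊞ Y) :=
  hP.sum _ (BinaryBiproduct.isBilimit X Y) hX hY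

end KrullSchmidt

/-! ### Bifunctoriality and biadditivity of extensions. -/

section Calculus

variable {C : Type u} [Category.{v} C] (E : Cᵒᵖ ⥤ C ⥤ AddCommGrpCat.{w})

@[simp]
theorem push_id {A B : C} (δ : Ext E B A) : push E (𝟙 A) δ = δ := by
  simp [push]

@[simp]
theorem pull_id {A B : C} (δ : Ext E B A) : pull E (𝟙 B) δ = δ := by
  simp [pull]

theorem push_comp {A A' A'' B : C} (a : A ⟶ A') (a' : A' ⟶ A'') (δ : Ext E B A) :
    push E (a ≫ a') δ = push E a' (push E a δ) := by
  simp [push]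

theorem pull_comp {A B B' B'' : C} (c : B' ⟶ B) (c' : B'' ⟶ B') (δ : Ext E B A) :
    pull E (c' ≫ c) δ = pull E c' (pull E c δ) := by
  simp [pull]

theorem push_pull {A A' B B' : C} (a : A ⟶ A') (c : B' ⟶ B) (δ : Ext E B A) :
    push E a (pull E c δ) = pull E c (push E a δ) := by
  have := (E.map c.op).naturality a
  exact (ConcreteCategory.congr_hom this δ).symm

@[simp]
theorem push_zero {A A' B : C} (a : A ⟶ A') : push E a (0 : Ext E B A) = 0 :=
  map_zero _

@[simp]
theorem pull_zero {A B B' : C} (c : B' ⟶ B) : pull E c (0 : Ext E B A) = 0 :=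
  map_zero _

theorem push_add {A A' B : C} (a : A ⟶ A') (δ δ' : Ext E B A) :
    push E a (δ + δ') = push E a δ + push E a δ' :=
  map_add _ _ _

theorem pull_add {A B B' : C} (c : B' ⟶ B) (δ δ' : Ext E B A) :
    pull E c (δ + δ') = pull E c δ + pull E c δ' :=
  map_add _ _ _

theorem push_sub {A A' B : C} (a : A ⟶ A') (δ δ' : Ext E B A) :
    push E a (δ - δ') = push E a δ - push E a δ' :=
  map_sub _ _ _

theorem pull_sub {A B B' : C} (c : B' ⟶ B) (δ δ' : Ext E B A) :
    pull E c (δ - δ') = pull E c δ - pull E c δ' :=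
  map_sub _ _ _

variable [Preadditive C]

theorem add_push {A A' B : C} [(E.obj (op B)).Additive] (a a' : A ⟶ A') (δ : Ext E B A) :
    push E (a + a') δ = push E a δ + push E a' δ := by
  simp [push, Functor.map_add]

theorem zero_push {A A' B : C} [(E.obj (op B)).Additive] (δ : Ext E B A) :
    push E (0 : A ⟶ A') δ = 0 := by
  simp [push]

theorem neg_push {A A' B : C} [(E.obj (op B)).Additive] (a : A ⟶ A') (δ : Ext E B A) :
    push E (-a) δ = -push E a δ := by
  simp [push, Functor.map_neg]

theorem add_pull {A B B' : C} [h : (E.flip.obj A).Additive] (c c' : B' ⟶ B) (δ : Ext E B A) :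
    pull E (c + c') δ = pull E c δ + pull E c' δ := by
  have := h.map_add (f := c.op) (g := c'.op)
  exact ConcreteCategory.congr_hom this δ

theorem zero_pull {A B B' : C} [h : (E.flip.obj A).Additive] (δ : Ext E B A) :
    pull E (0 : B' ⟶ B) δ = 0 := by
  have := Functor.map_zero (E.flip.obj A) (op B) (op B')
  exact ConcreteCategory.congr_hom this δ

theorem neg_pull {A B B' : C} [h : (E.flip.obj A).Additive] (c : B' ⟶ B) (δ : Ext E B A) :
    pull E (-c) δ = -pull E c δ := by
  rw [eq_neg_iff_add_eq_zero, ← add_pull, neg_add_cancel, zero_pull]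

end Calculus

/-! ### Removing contractible summands from complexes. -/

section Trim

variable {C : Type u} [Category.{v} C] [Preadditive C]

/-- A partial contraction `s` with `s d s = s` splits off a contractible direct summand. -/
theorem exists_homotopyRetract [IsIdempotentComplete C] {I : Type*} {c : ComplexShape I}
    (K : HomologicalComplex C c) {i j : I} (hij : c.Rel i j) (hne : i ≠ j)
    (s : K.X j ⟶ K.X i) (hs : s ≫ K.d i j ≫ s = s) :
    ∃ (L : HomologicalComplex C c) (a : L ⟶ K) (b : K ⟶ L), a ≫ b = 𝟙 L ∧
      Nonempty (Homotopy (b ≫ a) (𝟙 K)) ∧ b.f i ≫ a.f i = 𝟙 _ - K.d i j ≫ s ∧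
      b.f j ≫ a.f j = 𝟙 _ - s ≫ K.d i j ∧
      ∀ k, k ≠ i → k ≠ j → b.f k ≫ a.f k = 𝟙 _ := by
  classical
  -- The homotopy with single component `s`. Its null-homotopic map `φ` is `d s` in degree `i` and
  -- `s d` in degree `j`, hence idempotent; the complement of its image is homotopy equivalent to
  -- `K`.
  let H : ∀ k l, K.X k ⟶ K.X l := fun k l =>
    if h : k = j ∧ l = i then (K.XIsoOfEq h.1).hom ≫ s ≫ (K.XIsoOfEq h.2.symm).hom else 0
  have hH : H j i = s := by simp [H]
  have hH0 : ∀ k l, ¬ (k = j ∧ l = i) → H k l = 0 := fun k l h => dif_neg h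
  let φ : K ⟶ K := Homotopy.nullHomotopicMap H
  have hφi : φ.f i = K.d i j ≫ s := by
    have h1 : dNext i H = K.d i j ≫ s := by rw [dNext_eq H hij, hH]
    have h2 : prevD i H = 0 := by
      simp [prevD, hH0 i (c.prev i) (fun h => hne h.1)]
    exact (congrArg₂ (· + ·) h1 h2).trans (add_zero _)
  have hφj : φ.f j = s ≫ K.d i j := by
    have h1 : prevD j H = s ≫ K.d i j := by rw [prevD_eq H hij, hH]
    have h2 : dNext j H = 0 := by
      simp [dNext, hH0 (c.next j) j (fun h => hne h.2.symm)]
    exact (congrArg₂ (· + ·) h2 h1).trans (zero_add _)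
  have hφ : ∀ k, k ≠ i → k ≠ j → φ.f k = 0 := fun k hki hkj => by
    have h1 : prevD k H = 0 := by
      simp [prevD, hH0 k (c.prev k) (fun h => hkj h.1)]
    have h2 : dNext k H = 0 := by
      simp [dNext, hH0 (c.next k) k (fun h => hki h.2)]
    exact (congrArg₂ (· + ·) h2 h1).trans (add_zero _)
  have hidem : φ ≫ φ = φ := by
    ext k
    by_cases hki : k = i
    · subst hki
      simp [hφi, hs]
    · by_cases hkj : k = j
      · subst hkj
        have := congrArg (fun f => f ≫ K.d i k) hs
        simp only [Category.assoc] at this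
        simp [hφj, this]
      · simp [hφ k hki hkj]
  obtain ⟨L, a, b, hab, hba⟩ := IsIdempotentComplete.idempotents_split K (𝟙 K - φ)
    (by simp [hidem])
  have hf : ∀ k, b.f k ≫ a.f k = 𝟙 _ - φ.f k := fun k => by
    rw [← HomologicalComplex.comp_f, hba]; simp
  refine ⟨L, a, b, hab, ⟨?_⟩, by rw [hf, hφi], by rw [hf, hφj], fun k h h' => ?_⟩
  · have h0 : Homotopy φ 0 := Homotopy.nullHomotopy H
      (fun k l h => hH0 k l (fun h' => h (by rw [h'.1, h'.2]; exact hij)))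
    exact (Homotopy.ofEq (by rw [hba])).trans
      (((Homotopy.refl (𝟙 K)).add (h0.smul (-1 : ℤ))).trans (Homotopy.ofEq (by simp)) |> fun h =>
        (Homotopy.ofEq (by simp [sub_eq_add_neg])).trans h)
  · rw [hf, hφ k h h', sub_zero]

variable {n : ℕ} {A B : C}

/-- A realization may be trimmed along a partial contraction in the inner degrees. -/
theorem EndedComplex.exists_trim [IsIdempotentComplete C] (K : EndedComplex n A B)
    {i j : Fin (n + 2)} (hij : (shape n).Rel i j) (hi : i ≠ 0) (hj : j ≠ top n)
    (s : K.cpx.X j ⟶ K.cpx.X i) (hs : s ≫ K.cpx.d i j ≫ s = s) :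
    ∃ (L : EndedComplex n A B) (a : L.cpx ⟶ K.cpx) (b : K.cpx ⟶ L.cpx), L.Equivalent K ∧
      IsLift a (𝟙 A) (𝟙 B) ∧ a ≫ b = 𝟙 L.cpx ∧
      b.f i ≫ a.f i = 𝟙 _ - K.cpx.d i j ≫ s ∧ b.f j ≫ a.f j = 𝟙 _ - s ≫ K.cpx.d i j := by
  have hij' : (i : ℕ) + 1 = j := hij
  obtain ⟨L, a, b, hab, ⟨h⟩, h1, h2, h3⟩ := exists_homotopyRetract K.cpx hij
    (fun h => by rw [h] at hij'; omega) s hs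
  have hab' : ∀ k, a.f k ≫ b.f k = 𝟙 _ := fun k => by
    rw [← HomologicalComplex.comp_f, hab, HomologicalComplex.id_f]
  have h0 : b.f 0 ≫ a.f 0 = 𝟙 _ := h3 0 hi.symm (fun h => by subst h; simp at hij')
  have ht : b.f (top n) ≫ a.f (top n) = 𝟙 _ := h3 _ (fun h => by
    subst h
    have := j.2
    simp only at hij'
    omega) hj.symm
  let e₀ : L.X 0 ≅ K.cpx.X 0 := ⟨a.f 0, b.f 0, hab' 0, h0⟩
  let e₁ : L.X (top n) ≅ K.cpx.X (top n) := ⟨a.f _, b.f _, hab' _, ht⟩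
  let L' : EndedComplex n A B := ⟨L, e₀ ≪≫ K.source, e₁ ≪≫ K.target⟩
  have hba : ∀ {Z : C} (f : K.cpx.X 0 ⟶ Z), b.f 0 ≫ a.f 0 ≫ f = f := fun f => by
    rw [← Category.assoc, h0, Category.id_comp]
  have hba' : ∀ {Z : C} (f : K.cpx.X (top n) ⟶ Z), b.f (top n) ≫ a.f (top n) ≫ f = f :=
    fun f => by rw [← Category.assoc, ht, Category.id_comp]
  have hla : IsLift (X := L') (Y := K) a (𝟙 A) (𝟙 B) := by simp [IsLift, L', e₀, e₁]
  have hlb : IsLift (X := K) (Y := L') b (𝟙 A) (𝟙 B) := by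
    simp [IsLift, L', e₀, e₁, hba, hba']
  exact ⟨L', a, b, ⟨⟨a, b, Homotopy.ofEq hab, h⟩, hla, hlb⟩, hla, hab, h1, h2⟩

end Trim

/-! ### End differentials of mapping cones and cocones, in components. -/

section Cones

variable {C : Type u} [Category.{v} C] [Preadditive C] {n : ℕ}

namespace MappingConeData

variable {A B D : C} {X : EndedComplex n A B} {Y : EndedComplex n A D} {f : X.cpx ⟶ Y.cpx}
  {M : EndedComplex n (X.cpx.X (one n)) D} (m : MappingConeData f M)

theorem proj_eq {c : B ⟶ D} (hf : f.f (top n) ≫ Y.target.hom = X.target.hom ≫ c) :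
    M.proj = m.fst (pen n) (top n) ≫ X.target.hom ≫ c + m.snd (pen n) ≫ Y.proj := by
  have h := m.d_snd (pen n) (top n) rfl
  rw [m.snd_last] at h
  have h' := congrArg (fun g => g ≫ Y.target.hom) h
  simp only [Category.assoc, Iso.inv_hom_id, Category.comp_id, Preadditive.add_comp, hf] at h'
  exact h'

theorem inc_fst {k : Fin (n + 2)} (hk : (shape n).Rel (one n) k) :
    M.inc ≫ m.fst (one n) k = -X.cpx.d (one n) k := by
  have h := m.d_fst 0 (one n) k rfl hk
  simp [EndedComplex.inc, h, m.fst_first, -Fin.mk_one]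

theorem inc_snd : M.inc ≫ m.snd (one n) = f.f (one n) := by
  have h := m.d_snd 0 (one n) rfl
  simp [EndedComplex.inc, h, m.fst_first, m.snd_first, -Fin.mk_one]

end MappingConeData

namespace MappingCoconeData

variable {A A' B : C} {X : EndedComplex n A B} {Y : EndedComplex n A' B} {f : X.cpx ⟶ Y.cpx}
  {N : EndedComplex n A (Y.cpx.X (pen n))} (m : MappingCoconeData f N)

theorem inc_eq {a : A ⟶ A'} (hf : f.f 0 ≫ Y.source.hom = X.source.hom ≫ a) :
    N.inc = X.inc ≫ m.inl (one n) + a ≫ Y.source.inv ≫ m.inr 0 (one n) := by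
  have h := m.inl_d 0 (one n) rfl
  rw [m.inl_first] at h
  have hf' : X.source.inv ≫ f.f 0 = a ≫ Y.source.inv := by
    rw [Iso.inv_comp_eq, ← Category.assoc, ← hf]; simp
  have h' := congrArg (fun g => X.source.inv ≫ g) h
  simp only [Category.assoc, Iso.inv_hom_id_assoc, Preadditive.comp_add,
    reassoc_of% hf'] at h'
  simpa [EndedComplex.inc] using h'

theorem inr_proj {i : Fin (n + 2)} (hi : (shape n).Rel i (pen n)) :
    m.inr i (pen n) ≫ N.proj = -Y.cpx.d i (pen n) := by
  have h := m.inr_d i (pen n) (top n) hi rfl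
  have h' := congrArg (fun g => g ≫ N.target.hom) h
  simpa [EndedComplex.proj, m.inr_last] using h'

theorem inl_proj : m.inl (pen n) ≫ N.proj = f.f (pen n) := by
  have h := m.inl_d (pen n) (top n) rfl
  have h' := congrArg (fun g => g ≫ N.target.hom) h
  simpa [EndedComplex.proj, m.inr_last, m.inl_last] using h'

end MappingCoconeData

end Cones

/-! ### The exact sequences extended by one term on the extension side. -/

section Exactness

variable {C : Type u} [Category.{v} C] [Preadditive C] {n : ℕ}
  {E : Cᵒᵖ ⥤ C ⥤ AddCommGrpCat.{w}} {s : Correspondence n E}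

theorem exists_realizes (s : Correspondence n E) {A B : C} (δ : Ext E B A) :
    ∃ X : EndedComplex n A B, Realizes s δ X := by
  obtain ⟨X, hX⟩ := Quotient.exists_rep (s δ)
  exact ⟨X, hX.symm⟩

theorem Realizes.of_equivalent {A B : C} {δ : Ext E B A} {X Y : EndedComplex n A B}
    (hX : Realizes s δ X) (h : X.Equivalent Y) : Realizes s δ Y :=
  hX.trans (Quotient.sound h)

theorem Realizes.equivalent {A B : C} {δ : Ext E B A} {X Y : EndedComplex n A B}
    (hX : Realizes s δ X) (hY : Realizes s δ Y) : X.Equivalent Y :=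
  Quotient.exact (hX.symm.trans hY)

variable (hs : IsNExangulated E s)
include hs

theorem IsNExangulated.exangle {A B : C} {δ : Ext E B A} {X : EndedComplex n A B}
    (hX : Realizes s δ X) : IsExangle E X δ :=
  hs.exactRealization.exangle δ X hX

/-- Exactness of `C(-, B) ⟶ 𝔼(-, A) ⟶ 𝔼(-, Z₁)`. -/
theorem IsNExangulated.exists_pull_eq {A B D : C} {ζ : Ext E B A} {Z : EndedComplex n A B}
    (hZ : Realizes s ζ Z) (δ : Ext E D A) (h : push E Z.inc δ = 0) :
    ∃ c : D ⟶ B, pull E c ζ = δ := by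
  have := hs.hasFiniteBiproducts
  have := hasBinaryBiproducts_of_finite_biproducts C
  have := hs.additive_left
  let θ : Ext E (D ⊞ B) A := pull E biprod.fst δ + pull E biprod.snd ζ
  -- Gluing `δ` and `ζ` over `D ⊞ B` gives an extension restricting to `ζ` on `B`, so there is a
  -- good lift along `biprod.inr`.
  have hl : pull E biprod.inl θ = δ := by
    rw [pull_add, ← pull_comp, ← pull_comp]; simp [zero_pull]
  have hr : pull E biprod.inr θ = ζ := by
    rw [pull_add, ← pull_comp, ← pull_comp]; simp [zero_pull]
  have hθ : push E Z.inc θ = 0 := by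
    rw [push_add, push_pull, push_pull, h, (hs.exangle hZ).push_inc, pull_zero, pull_zero,
      add_zero]
  obtain ⟨R, hR⟩ := exists_realizes s θ
  obtain ⟨f, M, hf, ⟨m⟩, hM⟩ := hs.good_lift θ biprod.inr Z R (by rwa [hr]) hR
  -- The cone realizes `0`, so its last map has a section `g`. The part of `g ≫ M.proj` through
  -- `R.proj` pulls `θ` back to `0`; what remains factors through `B` and yields `c`.
  obtain ⟨g, hg⟩ := ((hs.exangle hM).exact_to_last (D ⊞ B) (𝟙 _)).1
    (by dsimp only; rw [pull_id, hθ])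
  refine ⟨biprod.inl ≫ g ≫ m.fst (pen n) (top n) ≫ Z.target.hom, ?_⟩
  have hR0 := (hs.exangle hR).pull_proj
  have h1 : pull E (biprod.inl ≫ g ≫ M.proj) θ = δ := by
    dsimp only at hg
    rw [hg, Category.comp_id, hl]
  rw [m.proj_eq hf.2, Preadditive.comp_add, Preadditive.comp_add, add_pull] at h1
  have h2 : pull E (biprod.inl ≫ g ≫ m.snd (pen n) ≫ R.proj) θ = 0 := by
    rw [pull_comp, pull_comp, pull_comp, hR0, pull_zero, pull_zero, pull_zero]
  rw [h2, add_zero] at h1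
  rw [← h1, ← hr, ← pull_comp]
  simp only [Category.assoc]

/-- Exactness of `C(A, -) ⟶ 𝔼(B, -) ⟶ 𝔼(Zₙ, -)`. -/
theorem IsNExangulated.exists_push_eq {A B D : C} {ζ : Ext E B A} {Z : EndedComplex n A B}
    (hZ : Realizes s ζ Z) (δ : Ext E B D) (h : pull E Z.proj δ = 0) :
    ∃ a : A ⟶ D, push E a ζ = δ := by
  have := hs.hasFiniteBiproducts
  have := hasBinaryBiproducts_of_finite_biproducts C
  have := hs.additive_right
  let θ : Ext E B (D ⊞ A) := push E biprod.inl δ + push E biprod.inr ζ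
  have hl : push E biprod.fst θ = δ := by
    rw [push_add, ← push_comp, ← push_comp]; simp [zero_push]
  have hr : push E biprod.snd θ = ζ := by
    rw [push_add, ← push_comp, ← push_comp]; simp [zero_push]
  have hθ : pull E Z.proj θ = 0 := by
    rw [pull_add, ← push_pull, ← push_pull, h, (hs.exangle hZ).pull_proj, push_zero, push_zero,
      add_zero]
  obtain ⟨R, hR⟩ := exists_realizes s θ
  obtain ⟨f, N, hf, ⟨m⟩, hN⟩ := hs.good_lift_op θ biprod.snd R Z hR (by rwa [hr])
  obtain ⟨g, hg⟩ := ((hs.exangle hN).exact_from_first (D ⊞ A) (𝟙 _)).1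
    (by dsimp only; rw [push_id, hθ])
  refine ⟨Z.source.inv ≫ m.inr 0 (one n) ≫ g ≫ biprod.fst, ?_⟩
  have hR0 := (hs.exangle hR).push_inc
  have h1 : push E (N.inc ≫ g ≫ biprod.fst) θ = δ := by
    dsimp only at hg
    rw [← Category.assoc, hg, Category.id_comp, hl]
  rw [m.inc_eq hf.1, Preadditive.add_comp, add_push, Category.assoc R.inc, push_comp _ R.inc, hR0,
    push_zero, zero_add, Category.assoc, push_comp, hr] at h1
  rw [← h1]
  simp

end Exactness

/-! ### Extensions of composites come from the subcategory. -/

section Composition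

variable {C : Type u} [Category.{v} C] [Preadditive C]

theorem exists_of_isLimit_binaryFan {X Y Z : C} {p : Z ⟶ X} {q : Z ⟶ Y}
    (h : Nonempty (IsLimit (BinaryFan.mk p q))) :
    ∃ (i : X ⟶ Z) (j : Y ⟶ Z), i ≫ p = 𝟙 X ∧ i ≫ q = 0 ∧ j ≫ p = 0 ∧ j ≫ q = 𝟙 Y ∧
      p ≫ i + q ≫ j = 𝟙 Z := by
  obtain ⟨h⟩ := h
  obtain ⟨(i : X ⟶ Z), (hip : i ≫ p = 𝟙 X), (hiq : i ≫ q = 0)⟩ :=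
    BinaryFan.IsLimit.lift' h (𝟙 X) 0
  obtain ⟨(j : Y ⟶ Z), (hjp : j ≫ p = 0), (hjq : j ≫ q = 𝟙 Y)⟩ :=
    BinaryFan.IsLimit.lift' h 0 (𝟙 Y)
  have hp : (p ≫ i + q ≫ j) ≫ p = 𝟙 Z ≫ p := by simp [hip, hjp]
  have hq : (p ≫ i + q ≫ j) ≫ q = 𝟙 Z ≫ q := by simp [hiq, hjq]
  exact ⟨i, j, hip, hiq, hjp, hjq, BinaryFan.IsLimit.hom_ext h hp hq⟩

theorem exists_of_isColimit_binaryCofan {X Y Z : C} {i : X ⟶ Z} {j : Y ⟶ Z}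
    (h : Nonempty (IsColimit (BinaryCofan.mk i j))) :
    ∃ (p : Z ⟶ X) (q : Z ⟶ Y), i ≫ p = 𝟙 X ∧ i ≫ q = 0 ∧ j ≫ p = 0 ∧ j ≫ q = 𝟙 Y ∧
      p ≫ i + q ≫ j = 𝟙 Z := by
  obtain ⟨h⟩ := h
  obtain ⟨(p : Z ⟶ X), (hip : i ≫ p = 𝟙 X), (hjp : j ≫ p = 0)⟩ :=
    BinaryCofan.IsColimit.desc' h (𝟙 X) 0
  obtain ⟨(q : Z ⟶ Y), (hiq : i ≫ q = 0), (hjq : j ≫ q = 𝟙 Y)⟩ :=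
    BinaryCofan.IsColimit.desc' h 0 (𝟙 Y)
  have hi : i ≫ (p ≫ i + q ≫ j) = i ≫ 𝟙 Z := by simp [reassoc_of% hip, reassoc_of% hiq]
  have hj : j ≫ (p ≫ i + q ≫ j) = j ≫ 𝟙 Z := by simp [reassoc_of% hjp, reassoc_of% hjq]
  exact ⟨p, q, hip, hiq, hjp, hjq, BinaryCofan.IsColimit.hom_ext h hi hj⟩

variable {n : ℕ}

namespace EndedComplex

variable {A A' B B' : C} {X : EndedComplex n A B} {Y : EndedComplex n A' B'}

theorem IsLift.inc_comp {f : X.cpx ⟶ Y.cpx} {a : A ⟶ A'} {c : B ⟶ B'} (h : IsLift f a c) :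
    X.inc ≫ f.f (one n) = a ≫ Y.inc := by
  have h' : X.source.inv ≫ f.f 0 = a ≫ Y.source.inv := by
    rw [Iso.inv_comp_eq, ← Category.assoc, ← h.1]; simp
  rw [inc, Category.assoc, ← f.comm, reassoc_of% h', inc]

theorem IsLift.comp_proj {f : X.cpx ⟶ Y.cpx} {a : A ⟶ A'} {c : B ⟶ B'} (h : IsLift f a c) :
    f.f (pen n) ≫ Y.proj = X.proj ≫ c := by
  simp [proj, h.2]

theorem inc_comp_d (X : EndedComplex n A B) (k : Fin (n + 2)) :
    X.inc ≫ X.cpx.d (one n) k = 0 := by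
  simp [inc, -Fin.mk_one]

theorem d_comp_proj (X : EndedComplex n A B) (k : Fin (n + 2)) :
    X.cpx.d k (pen n) ≫ X.proj = 0 := by
  simp [proj]

end EndedComplex

variable {E : Cᵒᵖ ⥤ C ⥤ AddCommGrpCat.{w}}

theorem IsExangle.exists_d_comp_eq {A B : C} {X : EndedComplex n A B} {δ : Ext E B A}
    (h : IsExangle E X δ) {k : Fin (n + 2)} (hk : (shape n).Rel (one n) k) {T : C}
    (g : X.cpx.X (one n) ⟶ T) (hg : X.inc ≫ g = 0) : ∃ l, X.cpx.d (one n) k ≫ l = g := by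
  refine (h.exact_from T 0 (one n) k rfl hk g).1 ?_
  have : X.cpx.d 0 (one n) = X.source.hom ≫ X.inc := by simp [EndedComplex.inc]
  dsimp only
  rw [this, Category.assoc, hg, comp_zero]

theorem IsExangle.exists_comp_d_eq {A B : C} {X : EndedComplex n A B} {δ : Ext E B A}
    (h : IsExangle E X δ) {k : Fin (n + 2)} (hk : (shape n).Rel k (pen n)) {T : C}
    (g : T ⟶ X.cpx.X (pen n)) (hg : g ≫ X.proj = 0) : ∃ l, l ≫ X.cpx.d k (pen n) = g := by
  refine (h.exact_to T k (pen n) (top n) hk rfl g).1 ?_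
  have : X.cpx.d (pen n) (top n) = X.proj ≫ X.target.inv := by simp [EndedComplex.proj]
  dsimp only
  rw [this, ← Category.assoc, hg, zero_comp]

theorem IsExangle.exists_inc_comp_eq {A B : C} {X : EndedComplex n A B} {δ : Ext E B A}
    (h : IsExangle E X δ) {T : C} (g : A ⟶ T) (hg : push E g δ = 0) : ∃ l, X.inc ≫ l = g :=
  (h.exact_from_first T g).1 hg

theorem IsExangle.exists_comp_proj_eq {A B : C} {X : EndedComplex n A B} {δ : Ext E B A}
    (h : IsExangle E X δ) {T : C} (g : T ⟶ B) (hg : pull E g δ = 0) : ∃ l, l ≫ X.proj = g :=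
  (h.exact_to_last T g).1 hg

variable {s : Correspondence n E} (hs : IsNExangulated E s) (hn : 1 ≤ n)
  {P : ObjectProperty C} (hP : IsAdditiveSubcategory P) (hext : IsNExtensionClosed s P)
include hs hn hP hext

/-- An extension realized by a composite of inflations of `P` is pulled back from `P`. -/
theorem exists_pull_eq_of_comp {A A' B X' Y' : C} {δ : Ext E X' A} {X : EndedComplex n A X'}
    (hX : Realizes s δ X) {ε : Ext E Y' A'} {Y : EndedComplex n A' Y'} (hY : Realizes s ε Y)
    (τ : X.cpx.X (one n) ≅ A') {ζ : Ext E B A} {Z : EndedComplex n A B} (hZ : Realizes s ζ Z)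
    (k₁ : Z.cpx.X (one n) ⟶ Y.cpx.X (one n)) (hk₁ : Z.inc ≫ k₁ = X.inc ≫ τ.hom ≫ Y.inc)
    (k₂ : Y.cpx.X (one n) ⟶ Z.cpx.X (one n)) (hk₂ : X.inc ≫ τ.hom ≫ Y.inc ≫ k₂ = Z.inc)
    (hPX : ∀ i, P (X.cpx.X i)) (hPY : P Y') :
    ∃ D, P D ∧ ∃ (θ : Ext E D A) (γ : B ⟶ D), pull E γ θ = ζ := by
  have := hs.hasFiniteBiproducts
  have := hasBinaryBiproducts_of_finite_biproducts C
  have := hs.additive_left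
  have := hs.additive_right
  let k : Fin (n + 2) := ⟨2, by omega⟩
  have hk : (shape n).Rel (one n) k := rfl
  have exX := hs.exangle hX
  have exZ := hs.exangle hZ
  -- the morphism of extensions from `δ` to `ζ`
  obtain ⟨c, hc⟩ := hs.exists_pull_eq hZ δ (by
    rw [← hk₂, push_comp, exX.push_inc, push_zero])
  obtain ⟨f, M, hf, ⟨m⟩, hM⟩ := hs.good_lift ζ c X Z (by rwa [hc]) hZ
  obtain ⟨l, hl⟩ := exX.exists_d_comp_eq hk (f.f (one n) - τ.hom ≫ Y.inc ≫ k₂) (by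
    rw [Preadditive.comp_sub, hf.inc_comp, hk₂, Category.id_comp, sub_self])
  -- the universal extension pulled back from `ε` and killed by `d₁`
  obtain ⟨ε', hε'⟩ : ∃ ε', ε' = push E τ.inv ε := ⟨_, rfl⟩
  have hε'' : push E (τ.hom ≫ Y.inc) ε' = 0 := by
    rw [hε', ← push_comp, Iso.inv_hom_id_assoc, (hs.exangle hY).push_inc]
  -- A morphism `c` into `Y'` factors through `T.proj` exactly when `d₁` kills `c^* ε'`. Extension
  -- closure puts `Tₙ` in `P`.
  obtain ⟨T, hT, hPT⟩ := hext (hPX k) hPY (push E (X.cpx.d (one n) k) ε')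
  have exT := hs.exangle hT
  have hν₁ : push E (X.cpx.d (one n) k) (pull E T.proj ε') = 0 := by
    rw [push_pull, exT.pull_proj]
  -- Modulo multiples of `d₁`, the map `f₁` factors through `τ.hom ≫ Y.inc`, which kills `ε'`.
  have hν₂ : push E (f.f (one n)) (pull E T.proj ε') = 0 := by
    have : f.f (one n) = X.cpx.d (one n) k ≫ l + (τ.hom ≫ Y.inc) ≫ k₂ := by
      rw [hl, Category.assoc, sub_add_cancel]
    rw [this, add_push, push_comp, hν₁, push_zero, push_comp, push_pull, hε'', pull_zero,
      push_zero, add_zero]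
  have hlim := m.isProduct (one n) k hk (by simp)
  obtain ⟨i, j, -, -, -, -, hij⟩ := exists_of_isLimit_binaryFan hlim
  have hinc : M.inc = -X.cpx.d (one n) k ≫ i + f.f (one n) ≫ j := by
    rw [← Category.comp_id M.inc, ← hij, Preadditive.comp_add, ← Category.assoc,
      ← Category.assoc, m.inc_fst hk, m.inc_snd, Preadditive.neg_comp]
  -- Both components `-d₁` and `f₁` of `M.inc` kill this class, so it is a pullback of the extension
  -- `(X.inc)_* ζ` realized by `M`.
  obtain ⟨e, he⟩ := hs.exists_pull_eq hM (pull E T.proj ε') (by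
    rw [hinc, add_push, neg_push, push_comp, hν₁, push_comp, hν₂, push_zero, push_zero, neg_zero,
      add_zero])
  -- the comparison of `(d₀)_* ζ` with `ε`
  obtain ⟨c₂, hc₂⟩ := hs.exists_pull_eq hY (push E (X.inc ≫ τ.hom) ζ) (by
    rw [← push_comp, Category.assoc, ← hk₁, push_comp, exZ.push_inc, push_zero])
  have hc₂' : pull E c₂ ε' = push E X.inc ζ := by
    rw [hε', ← push_pull, hc₂, ← push_comp, Category.assoc, Iso.hom_inv_id, Category.comp_id]
  obtain ⟨c₁, hc₁⟩ := exT.exists_comp_proj_eq c₂ (by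
    rw [← push_pull, hc₂', ← push_comp, X.inc_comp_d, zero_push])
  -- Pulling `(X.inc)_* ζ` back along `c₁ ≫ e` gives `c₂^* ε'`, which is `(X.inc)_* ζ` again. So the
  -- difference is killed by `X.inc` and comes from `δ`; `ζ` is therefore pulled back from `Tₙ ⊞
  -- X'`.
  obtain ⟨t, ht⟩ := hs.exists_pull_eq hX (ζ - pull E c₁ (pull E e ζ)) (by
    rw [push_sub, push_pull, push_pull, he, ← pull_comp, hc₁, hc₂', sub_self])
  refine ⟨T.cpx.X (pen n) ⊞ X', hP.biprod (hPT _) (hP.iso X.target (hPX _)),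
    pull E biprod.fst (pull E e ζ) + pull E biprod.snd δ, biprod.lift c₁ t, ?_⟩
  rw [pull_add, ← pull_comp, ← pull_comp _ _ (biprod.lift c₁ t), biprod.lift_fst,
    biprod.lift_snd, ht, add_sub_cancel]

/-- An extension realized by a composite of deflations of `P` is pushed forward from `P`. -/
theorem exists_push_eq_of_comp {A B B' X' Y' : C} {δ : Ext E B X'} {X : EndedComplex n X' B}
    (hX : Realizes s δ X) {ε : Ext E B' Y'} {Y : EndedComplex n Y' B'} (hY : Realizes s ε Y)
    (τ : B' ≅ X.cpx.X (pen n)) {ζ : Ext E B A} {Z : EndedComplex n A B} (hZ : Realizes s ζ Z)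
    (k₁ : Y.cpx.X (pen n) ⟶ Z.cpx.X (pen n)) (hk₁ : k₁ ≫ Z.proj = Y.proj ≫ τ.hom ≫ X.proj)
    (k₂ : Z.cpx.X (pen n) ⟶ Y.cpx.X (pen n)) (hk₂ : k₂ ≫ Y.proj ≫ τ.hom ≫ X.proj = Z.proj)
    (hPX : ∀ i, P (X.cpx.X i)) (hPY : P Y') :
    ∃ D, P D ∧ ∃ (θ : Ext E B D) (γ : D ⟶ A), push E γ θ = ζ := by
  have := hs.hasFiniteBiproducts
  have := hasBinaryBiproducts_of_finite_biproducts C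
  have := hs.additive_left
  have := hs.additive_right
  let k : Fin (n + 2) := ⟨n - 1, by omega⟩
  have hk : (shape n).Rel k (pen n) := Nat.sub_add_cancel hn
  have exX := hs.exangle hX
  have exZ := hs.exangle hZ
  obtain ⟨c, hc⟩ := hs.exists_push_eq hZ δ (by
    rw [← hk₂, ← Category.assoc, ← Category.assoc, pull_comp, exX.pull_proj, pull_zero])
  obtain ⟨f, N, hf, ⟨m⟩, hN⟩ := hs.good_lift_op ζ c Z X hZ (by rwa [hc])
  obtain ⟨l, hl⟩ := exX.exists_comp_d_eq hk (f.f (pen n) - k₂ ≫ Y.proj ≫ τ.hom) (by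
    simp only [Preadditive.sub_comp, hf.comp_proj, Category.assoc, hk₂, Category.comp_id,
      sub_self])
  obtain ⟨ε', hε'⟩ : ∃ ε', ε' = pull E τ.inv ε := ⟨_, rfl⟩
  have hε'' : pull E (Y.proj ≫ τ.hom) ε' = 0 := by
    rw [hε', ← pull_comp, Category.assoc, Iso.hom_inv_id, Category.comp_id,
      (hs.exangle hY).pull_proj]
  obtain ⟨T, hT, hPT⟩ := hext hPY (hPX k) (pull E (X.cpx.d k (pen n)) ε')
  have exT := hs.exangle hT
  have hν₁ : pull E (X.cpx.d k (pen n)) (push E T.inc ε') = 0 := by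
    rw [← push_pull, exT.push_inc]
  have hν₂ : pull E (f.f (pen n)) (push E T.inc ε') = 0 := by
    have : f.f (pen n) = l ≫ X.cpx.d k (pen n) + k₂ ≫ Y.proj ≫ τ.hom := by
      rw [hl, sub_add_cancel]
    rw [this, add_pull, pull_comp, hν₁, pull_zero, pull_comp, ← push_pull, hε'', push_zero,
      pull_zero, add_zero]
  have hcolim := m.isCoproduct k (pen n) hk (by simp [Fin.ext_iff])
  obtain ⟨p, q, -, -, -, -, hpq⟩ := exists_of_isColimit_binaryCofan hcolim
  have hproj : N.proj = p ≫ f.f (pen n) + -(q ≫ X.cpx.d k (pen n)) := by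
    rw [← Category.id_comp N.proj, ← hpq, Preadditive.add_comp, Category.assoc,
      Category.assoc, m.inr_proj hk, m.inl_proj, Preadditive.comp_neg]
  obtain ⟨e, he⟩ := hs.exists_push_eq hN (push E T.inc ε') (by
    rw [hproj, add_pull, neg_pull, pull_comp, hν₂, pull_comp, hν₁, pull_zero, pull_zero, neg_zero,
      add_zero])
  obtain ⟨c₂, hc₂⟩ := hs.exists_push_eq hY (pull E (τ.hom ≫ X.proj) ζ) (by
    rw [← pull_comp, ← hk₁, pull_comp, exZ.pull_proj, pull_zero])
  have hc₂' : push E c₂ ε' = pull E X.proj ζ := by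
    rw [hε', push_pull, hc₂, ← pull_comp, Iso.inv_hom_id_assoc]
  obtain ⟨c₁, hc₁⟩ := exT.exists_inc_comp_eq c₂ (by
    rw [push_pull, hc₂', ← pull_comp, X.d_comp_proj, zero_pull])
  -- Dually, `ζ` and its push-forward along `e ≫ c₁` agree after pulling back along `X.proj`, so
  -- they differ by a push-forward of `δ`.
  obtain ⟨t, ht⟩ := hs.exists_push_eq hX (ζ - push E c₁ (push E e ζ)) (by
    rw [pull_sub, ← push_pull, ← push_pull, he, ← push_comp, hc₁, hc₂', sub_self])
  refine ⟨T.cpx.X (one n) ⊞ X', hP.biprod (hPT _) (hP.iso X.source (hPX _)),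
    push E biprod.inl (push E e ζ) + push E biprod.inr δ, biprod.desc c₁ t, ?_⟩
  rw [push_add, ← push_comp, ← push_comp _ _ (biprod.desc c₁ t), biprod.inl_desc,
    biprod.inr_desc, ht, add_sub_cancel]

end Composition

/-! ### Replacing a realization by one inside the subcategory. -/

section Closure

variable {C : Type u} [Category.{v} C] [Preadditive C] {n : ℕ}

theorem EndedComplex.nonempty_arrowIso_of_inc {A B B' : C} {X : EndedComplex n A B}
    {Y : EndedComplex n A B'} (φ : X.cpx.X (one n) ≅ Y.cpx.X (one n))
    (h : X.inc ≫ φ.hom = Y.inc) :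
    Nonempty (Arrow.mk (X.cpx.d 0 (one n)) ≅ Arrow.mk (Y.cpx.d 0 (one n))) := by
  refine ⟨Arrow.isoMk (X.source ≪≫ Y.source.symm) φ ?_⟩
  have : X.cpx.d 0 (one n) = X.source.hom ≫ X.inc := by simp [inc]
  simp only [Arrow.mk_hom, Iso.trans_hom, Iso.symm_hom, Category.assoc]
  rw [this, Category.assoc, h]
  rfl

theorem EndedComplex.nonempty_arrowIso_of_proj {A A' B : C} {X : EndedComplex n A B}
    {Y : EndedComplex n A' B} (φ : X.cpx.X (pen n) ≅ Y.cpx.X (pen n))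
    (h : φ.hom ≫ Y.proj = X.proj) :
    Nonempty (Arrow.mk (X.cpx.d (pen n) (top n)) ≅ Arrow.mk (Y.cpx.d (pen n) (top n))) := by
  refine ⟨Arrow.isoMk φ (X.target ≪≫ Y.target.symm) ?_⟩
  have : Y.cpx.d (pen n) (top n) = Y.proj ≫ Y.target.inv := by simp [proj]
  simp only [Arrow.mk_hom, Iso.trans_hom, Iso.symm_hom]
  rw [this, reassoc_of% h, ← Category.assoc]
  rfl

/-- A term of a complex is a retract of a sum of terms of a homotopy equivalent complex and of
adjacent terms. -/
theorem nonempty_retract_of_homotopyEquiv [HasBinaryBiproducts C] {I : Type*}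
    {c : ComplexShape I} {K L : HomologicalComplex C c} (e : HomotopyEquiv K L) {i j k : I}
    (hij : c.Rel i j) (hjk : c.Rel j k) :
    Nonempty (Retract (K.X j) (L.X j ⊞ (K.X k ⊞ K.X i))) := by
  have h := e.homotopyHomInvId.comm j
  rw [dNext_eq _ hjk, prevD_eq _ hij, HomologicalComplex.comp_f, HomologicalComplex.id_f] at h
  refine ⟨⟨biprod.lift (e.hom.f j)
      (biprod.lift (K.d j k) (e.homotopyHomInvId.hom j i)),
    biprod.desc (e.inv.f j) (biprod.desc (-e.homotopyHomInvId.hom k j) (-K.d i j)), ?_⟩⟩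
  simp only [biprod.lift_desc, h, Preadditive.comp_neg]
  abel

variable [IsIdempotentComplete C] [HasBinaryBiproducts C] {P : ObjectProperty C}
  (hP : IsAdditiveSubcategory P)
include hP

theorem MappingConeData.prop {A B D : C} {X : EndedComplex n A B} {Y : EndedComplex n A D}
    {f : X.cpx ⟶ Y.cpx} {M : EndedComplex n (X.cpx.X (one n)) D} (m : MappingConeData f M)
    (hX : ∀ i, P (X.cpx.X i)) (hY : ∀ i, P (Y.cpx.X i)) (i : Fin (n + 2)) :
    P (M.cpx.X i) := by
  by_cases hi : i = 0
  · subst hi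
    exact hP.iso M.source.symm (hX _)
  by_cases hi' : i = top n
  · subst hi'
    exact hP.iso (Y.target ≪≫ M.target.symm) (hY _)
  let j : Fin (n + 2) := ⟨i + 1, by
    have := i.2
    have : (i : ℕ) ≠ n + 1 := fun h => hi' (Fin.ext h)
    omega⟩
  obtain ⟨a, b, -, -, -, -, h⟩ := exists_of_isLimit_binaryFan (m.isProduct i j rfl hi)
  exact hP.of_retract ⟨biprod.lift _ _, biprod.desc a b, by rw [biprod.lift_desc, h]⟩
    (hP.biprod (hX j) (hY i))

theorem MappingCoconeData.prop {A A' B : C} {X : EndedComplex n A B} {Y : EndedComplex n A' B}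
    {f : X.cpx ⟶ Y.cpx} {N : EndedComplex n A (Y.cpx.X (pen n))} (m : MappingCoconeData f N)
    (hX : ∀ i, P (X.cpx.X i)) (hY : ∀ i, P (Y.cpx.X i)) (j : Fin (n + 2)) :
    P (N.cpx.X j) := by
  by_cases hj : j = 0
  · subst hj
    exact hP.iso (X.source ≪≫ N.source.symm) (hX _)
  by_cases hj' : j = top n
  · subst hj'
    exact hP.iso N.target.symm (hY _)
  let i : Fin (n + 2) := ⟨j - 1, by omega⟩
  have hij : (shape n).Rel i j := by
    have : (j : ℕ) ≠ 0 := fun h => hj (Fin.ext h)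
    change (j : ℕ) - 1 + 1 = j
    omega
  obtain ⟨a, b, -, -, -, -, h⟩ := exists_of_isColimit_binaryCofan (m.isCoproduct i j hij hj')
  exact hP.of_retract ⟨biprod.lift a b, biprod.desc _ _, by rw [biprod.lift_desc, h]⟩
    (hP.biprod (hX j) (hY i))

variable {E : Cᵒᵖ ⥤ C ⥤ AddCommGrpCat.{w}} {s : Correspondence n E} (hs : IsNExangulated E s)
  (hn : 1 ≤ n) (hext : IsNExtensionClosed s P)
include hs hn hext

/-- The last term `B` need not be in `P`, so `ζ` itself may have to be replaced. The new extension
is a pullback of `θ` along `S.proj` when `n ≥ 2`. -/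
theorem exists_realizes_of_pull_eq {A B D : C} {ζ : Ext E B A} {Z : EndedComplex n A B}
    (hZ : Realizes s ζ Z) (hA : P A) (hZ₁ : P (Z.cpx.X (one n))) (hD : P D) (θ : Ext E D A)
    (γ : B ⟶ D) (hγ : pull E γ θ = ζ) :
    ∃ (B' : C) (ξ : Ext E B' A) (L : EndedComplex n A B'), Realizes s ξ L ∧
      (∀ i, P (L.cpx.X i)) ∧
      Nonempty (Arrow.mk (Z.cpx.d 0 (one n)) ≅ Arrow.mk (L.cpx.d 0 (one n))) := by
  obtain ⟨Q, hQ, hPQ⟩ := hext hA hD θ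
  -- For `n = 1` degree `2` is an end term and cannot be trimmed. Instead the cone of `Z ⟶ Q`
  -- realizes an extension between objects of `P`, so its middle term, which contains `Z₂` as a
  -- summand, is in `P`.
  obtain rfl | hn' := hn.eq_or_lt
  · obtain ⟨f, M, hf, ⟨m⟩, hM⟩ := hs.good_lift θ γ Z Q (by rwa [hγ]) hQ
    obtain ⟨S, hS, hPS⟩ := hext hZ₁ hD (push E Z.inc θ)
    obtain ⟨e, -, -⟩ := hM.equivalent hS
    obtain ⟨r⟩ := nonempty_retract_of_homotopyEquiv e (i := 0) (j := one 1) (k := top 1) rfl rfl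
    have hPM : P (M.cpx.X (one 1)) := hP.of_retract r (hP.biprod (hPS _)
      (hP.biprod (hP.iso M.target.symm hD) (hP.iso M.source.symm hZ₁)))
    obtain ⟨a, b, ha, -, -, -, -⟩ :=
      exists_of_isLimit_binaryFan (m.isProduct (one 1) (top 1) rfl (by simp))
    have hZ₂ : P (Z.cpx.X (top 1)) := hP.of_retract ⟨a, _, ha⟩ hPM
    refine ⟨B, ζ, Z, hZ, fun i => ?_, ⟨Iso.refl _⟩⟩
    fin_cases i
    exacts [hP.iso Z.source.symm hA, hZ₁, hZ₂]
  · obtain ⟨h, hh⟩ := (hs.exangle hZ).exists_inc_comp_eq Q.inc (by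
      rw [← hγ, push_pull, (hs.exangle hQ).push_inc, pull_zero])
    obtain ⟨S, hS, hPS⟩ := hext hZ₁ hD (push E Z.inc θ)
    obtain ⟨f, N, hf, ⟨m⟩, hN⟩ := hs.good_lift_op θ Z.inc Q S hQ hS
    have hPN := m.prop hP hPQ hPS
    have h1 : one n ≠ top n := fun h => by simp [Fin.ext_iff] at h; omega
    obtain ⟨p, q, hp, hq, hp', hq', hpq⟩ :=
      exists_of_isColimit_binaryCofan (m.isCoproduct 0 (one n) rfl h1)
    let k : Fin (n + 2) := ⟨2, by omega⟩
    have hk : (shape n).Rel (one n) k := rfl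
    -- `N₁` is the sum of `Z₁` and `Q₁`, in such a way that `A ⟶ N₁` factors through `Z₁`
    obtain ⟨j, hj⟩ : ∃ j, j = h ≫ m.inl (one n) + S.source.inv ≫ m.inr 0 (one n) := ⟨_, rfl⟩
    obtain ⟨z, hz⟩ : ∃ z, z = q ≫ S.source.hom := ⟨_, rfl⟩
    obtain ⟨y, hy⟩ : ∃ y, y = p - z ≫ h := ⟨_, rfl⟩
    have hinc : N.inc = Z.inc ≫ j := by
      rw [m.inc_eq hf.1, ← hh, hj, Preadditive.comp_add, Category.assoc]
    have hjz : j ≫ z = 𝟙 _ := by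
      rw [hj, hz]; simp [reassoc_of% hq, reassoc_of% hq', -Fin.mk_one]
    have hjy : j ≫ y = 0 := by
      rw [hy, Preadditive.comp_sub, reassoc_of% hjz, hj]; simp [hp, hp', -Fin.mk_one]
    have hly : m.inl (one n) ≫ y = 𝟙 _ := by
      rw [hy, hz]; simp [hp, reassoc_of% hq, -Fin.mk_one]
    have htotal : 𝟙 _ - y ≫ m.inl (one n) = z ≫ j := by
      rw [← hpq, hy, hj, hz]; simp [-Fin.mk_one]; abel
    obtain ⟨r, hr⟩ := (hs.exangle hN).exists_d_comp_eq hk y (by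
      rw [hinc, Category.assoc, hjy, comp_zero])
    -- The partial contraction `N₂ ⟶ Q₁ ⟶ N₁` removes the copy of `Q₁`; by `htotal` precisely `Z₁`
    -- survives in degree `1`. Degree `2` is inner because `n ≥ 2`.
    obtain ⟨L, a, b, hL, hla, hab, hba, -⟩ := N.exists_trim hk (by simp)
      (fun h => by simp [k, Fin.ext_iff] at h; omega) (r ≫ m.inl (one n))
      (by rw [Category.assoc, reassoc_of% hr, reassoc_of% hly])
    have hab' : ∀ i, a.f i ≫ b.f i = 𝟙 _ := fun i => by
      rw [← HomologicalComplex.comp_f, hab, HomologicalComplex.id_f]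
    rw [reassoc_of% hr, htotal] at hba
    refine ⟨_, _, L, hN.of_equivalent (EndedComplex.equivalent_equivalence.symm hL),
      fun i => hP.of_retract ⟨a.f i, b.f i, hab' i⟩ (hPN i),
      EndedComplex.nonempty_arrowIso_of_inc ⟨j ≫ b.f _, a.f _ ≫ z, ?_, ?_⟩ ?_⟩
    · rw [Category.assoc, reassoc_of% hba, hjz, Category.comp_id, hjz]
    · rw [Category.assoc, ← reassoc_of% hba, hab' (one n), Category.comp_id, hab' (one n)]
    · dsimp only
      rw [← Category.assoc, ← hinc]
      have := hla.inc_comp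
      rw [Category.id_comp] at this
      rw [← this, Category.assoc, hab' (one n), Category.comp_id]

/-- Dual of `exists_realizes_of_pull_eq`: a mapping cone replaces the cocone, and `Qₙ` is split off
from degrees `n - 1` and `n`. -/
theorem exists_realizes_of_push_eq {A B D : C} {ζ : Ext E B A} {Z : EndedComplex n A B}
    (hZ : Realizes s ζ Z) (hB : P B) (hZ₁ : P (Z.cpx.X (pen n))) (hD : P D) (θ : Ext E B D)
    (γ : D ⟶ A) (hγ : push E γ θ = ζ) :
    ∃ (A' : C) (ξ : Ext E B A') (L : EndedComplex n A' B), Realizes s ξ L ∧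
      (∀ i, P (L.cpx.X i)) ∧
      Nonempty (Arrow.mk (Z.cpx.d (pen n) (top n)) ≅ Arrow.mk (L.cpx.d (pen n) (top n))) := by
  obtain ⟨Q, hQ, hPQ⟩ := hext hD hB θ
  obtain rfl | hn' := hn.eq_or_lt
  · obtain ⟨f, N, hf, ⟨m⟩, hN⟩ := hs.good_lift_op θ γ Q Z hQ (by rwa [hγ])
    obtain ⟨S, hS, hPS⟩ := hext hD hZ₁ (pull E Z.proj θ)
    obtain ⟨e, -, -⟩ := hN.equivalent hS
    obtain ⟨r⟩ := nonempty_retract_of_homotopyEquiv e (i := 0) (j := one 1) (k := top 1) rfl rfl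
    have hPN : P (N.cpx.X (one 1)) := hP.of_retract r (hP.biprod (hPS _)
      (hP.biprod (hP.iso N.target.symm hZ₁) (hP.iso N.source.symm hD)))
    obtain ⟨a, b, -, -, -, hb, -⟩ :=
      exists_of_isColimit_binaryCofan (m.isCoproduct 0 (one 1) rfl (by simp [Fin.ext_iff]))
    have hZ₀ : P (Z.cpx.X 0) := hP.of_retract ⟨_, b, hb⟩ hPN
    refine ⟨A, ζ, Z, hZ, fun i => ?_, ⟨Iso.refl _⟩⟩
    fin_cases i
    exacts [hZ₀, hZ₁, hP.iso Z.target.symm hB]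
  · obtain ⟨h, hh⟩ := (hs.exangle hZ).exists_comp_proj_eq Q.proj (by
      rw [← hγ, ← push_pull, (hs.exangle hQ).pull_proj, push_zero])
    obtain ⟨S, hS, hPS⟩ := hext hD hZ₁ (pull E Z.proj θ)
    obtain ⟨f, M, hf, ⟨m⟩, hM⟩ := hs.good_lift θ Z.proj S Q hS hQ
    have hPM := m.prop hP hPS hPQ
    have h1 : pen n ≠ 0 := fun h => by simp [Fin.ext_iff] at h; omega
    obtain ⟨p, q, hp, hq, hp', hq', hpq⟩ :=
      exists_of_isLimit_binaryFan (m.isProduct (pen n) (top n) rfl h1)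
    let k : Fin (n + 2) := ⟨n - 1, by omega⟩
    have hk : (shape n).Rel k (pen n) := Nat.sub_add_cancel hn
    -- `Mₙ` is the sum of `Zₙ` and `Qₙ`, in such a way that `Mₙ ⟶ B` factors through `Zₙ`
    obtain ⟨z, hz⟩ : ∃ z, z = m.fst (pen n) (top n) ≫ S.target.hom + m.snd (pen n) ≫ h :=
      ⟨_, rfl⟩
    obtain ⟨j, hj⟩ : ∃ j, j = S.target.inv ≫ p := ⟨_, rfl⟩
    obtain ⟨y, hy⟩ : ∃ y, y = q - h ≫ j := ⟨_, rfl⟩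
    have hproj : M.proj = z ≫ Z.proj := by
      rw [m.proj_eq hf.2, ← hh, hz]; simp
    have hjz : j ≫ z = 𝟙 _ := by
      rw [hj, hz]; simp [reassoc_of% hp, reassoc_of% hq]
    have hyz : y ≫ z = 0 := by
      rw [hy, Preadditive.sub_comp, Category.assoc, hjz, hz]
      simp [reassoc_of% hp', reassoc_of% hq']
    have hys : y ≫ m.snd (pen n) = 𝟙 _ := by
      rw [hy, hj]; simp [hq, hq']
    have htotal : 𝟙 _ - m.snd (pen n) ≫ y = z ≫ j := by
      rw [← hpq, hy, hz, hj]; simp; abel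
    obtain ⟨r, hr⟩ := (hs.exangle hM).exists_comp_d_eq hk y (by
      rw [hproj, ← Category.assoc, hyz, zero_comp])
    obtain ⟨L, a, b, hL, hla, hab, -, hba⟩ := M.exists_trim hk
      (fun h => by simp [k, Fin.ext_iff] at h; omega) (by simp [Fin.ext_iff])
      (m.snd (pen n) ≫ r) (by rw [Category.assoc, reassoc_of% hr, reassoc_of% hys])
    have hab' : ∀ i, a.f i ≫ b.f i = 𝟙 _ := fun i => by
      rw [← HomologicalComplex.comp_f, hab, HomologicalComplex.id_f]
    rw [Category.assoc, hr, htotal] at hba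
    refine ⟨_, _, L, hM.of_equivalent (EndedComplex.equivalent_equivalence.symm hL),
      fun i => hP.of_retract ⟨a.f i, b.f i, hab' i⟩ (hPM i),
      EndedComplex.nonempty_arrowIso_of_proj ⟨j ≫ b.f _, a.f _ ≫ z, ?_, ?_⟩ ?_⟩
    · rw [Category.assoc, reassoc_of% hba, hjz, Category.comp_id, hjz]
    · rw [Category.assoc, ← reassoc_of% hba, hab' (pen n), Category.comp_id, hab' (pen n)]
    · dsimp only
      have := hla.comp_proj
      rw [Category.comp_id] at this
      rw [← this, hproj, Category.assoc, reassoc_of% hba, reassoc_of% hjz, reassoc_of% hjz]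

end Closure

/-! ### Composites of inflations and of deflations. -/

section Arrows

variable {C : Type u} [Category.{v} C]

theorem exists_eq_of_arrowIso {U V X Y : C} {f : U ⟶ V} {d : X ⟶ Y}
    (e : Arrow.mk f ≅ Arrow.mk d) : ∃ (a : U ≅ X) (b : V ≅ Y), d = a.inv ≫ f ≫ b.hom := by
  let a : U ≅ X := Arrow.leftFunc.mapIso e
  let b : V ≅ Y := Arrow.rightFunc.mapIso e
  exact ⟨a, b, a.eq_inv_comp.2 e.hom.w⟩

variable [Preadditive C] {n : ℕ} {E : Cᵒᵖ ⥤ C ⥤ AddCommGrpCat.{w}} {s : Correspondence n E}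
  [IsIdempotentComplete C] {P : ObjectProperty C}
  (hP : IsAdditiveSubcategory P) (hs : IsNExangulated E s)
  (hn : 1 ≤ n) (hext : IsNExtensionClosed s P)
include hP hs hn hext

/-- A composite of inflations of `P` is an inflation of `P`. -/
theorem exists_realizes_of_inflation_comp {A A' X' Y' U V W : C} {δ : Ext E X' A}
    {X : EndedComplex n A X'} (hX : Realizes s δ X) (hPX : ∀ i, P (X.cpx.X i))
    {ε : Ext E Y' A'} {Y : EndedComplex n A' Y'} (hY : Realizes s ε Y)
    (hPY : ∀ i, P (Y.cpx.X i)) {f : U ⟶ V} (ef : Arrow.mk f ≅ Arrow.mk (X.cpx.d 0 (one n)))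
    {g : V ⟶ W} (eg : Arrow.mk g ≅ Arrow.mk (Y.cpx.d 0 (one n))) :
    ∃ (A₁ B₁ : C) (ξ : Ext E B₁ A₁) (L : EndedComplex n A₁ B₁), Realizes s ξ L ∧
      (∀ i, P (L.cpx.X i)) ∧ Nonempty (Arrow.mk (f ≫ g) ≅ Arrow.mk (L.cpx.d 0 (one n))) := by
  have := hs.hasFiniteBiproducts
  have := hasBinaryBiproducts_of_finite_biproducts C
  obtain ⟨A₂, B, ζ, Z, hZ, ⟨ez⟩⟩ := hs.inflation_comp f g ⟨A, X', δ, X, hX, ⟨ef⟩⟩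
    ⟨A', Y', ε, Y, hY, ⟨eg⟩⟩
  obtain ⟨a, b, hab⟩ := exists_eq_of_arrowIso ef
  obtain ⟨a', b', hab'⟩ := exists_eq_of_arrowIso eg
  obtain ⟨p, q, hpq⟩ := exists_eq_of_arrowIso ez
  -- The composite determines its source only up to isomorphism, so `ζ` is transported to start at
  -- `A`.
  let u : A₂ ≅ A := Z.source.symm ≪≫ p.symm ≪≫ a ≪≫ X.source
  obtain ⟨Z', hZ'⟩ := exists_realizes s (push E u.hom ζ)
  obtain ⟨F, hF⟩ := hs.exactRealization.lift _ _ Z Z' hZ hZ' u.hom (𝟙 B) (by simp)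
  obtain ⟨G, hG⟩ := hs.exactRealization.lift _ _ Z' Z hZ' hZ u.inv (𝟙 B) (by
    rw [← push_comp]; simp)
  have hF' := hF.inc_comp
  have hG' := hG.inc_comp
  -- `Z'₁` need not be isomorphic to `Z₁`; the lifts `F` and `G` give factorizations in both
  -- directions, which is all that is required.
  obtain ⟨D, hD, θ, γ, hγ⟩ := exists_pull_eq_of_comp hs hn hP hext hX hY
    (b.symm ≪≫ a' ≪≫ Y.source) hZ'
    (G.f (one n) ≫ q.inv ≫ b'.hom) (by
      rw [reassoc_of% hG']
      simp [EndedComplex.inc, hab, hab', hpq, u, -Fin.mk_one])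
    (b'.inv ≫ q.hom ≫ F.f (one n)) (by
      have h1 : Z'.inc = u.inv ≫ Z.inc ≫ F.f (one n) := by rw [hF', Iso.inv_hom_id_assoc]
      rw [h1]
      simp [EndedComplex.inc, hab, hab', hpq, u, -Fin.mk_one]) hPX
    (hP.iso Y.target (hPY _))
  obtain ⟨B₁, ξ, L, hL, hPL, ⟨eL⟩⟩ := exists_realizes_of_pull_eq hP hs hn hext hZ
    (hP.iso (X.source ≪≫ u.symm) (hPX _)) (hP.iso (b'.symm ≪≫ q) (hPY _)) hD (push E u.inv θ) γ
    (by rw [← push_pull, hγ, ← push_comp]; simp)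
  exact ⟨A₂, B₁, ξ, L, hL, hPL, ⟨ez ≪≫ eL⟩⟩

/-- A composite of deflations of `P` is a deflation of `P`. -/
theorem exists_realizes_of_deflation_comp {B B' X' Y' U V W : C} {δ : Ext E B X'}
    {X : EndedComplex n X' B} (hX : Realizes s δ X) (hPX : ∀ i, P (X.cpx.X i))
    {ε : Ext E B' Y'} {Y : EndedComplex n Y' B'} (hY : Realizes s ε Y)
    (hPY : ∀ i, P (Y.cpx.X i)) {f : U ⟶ V}
    (ef : Arrow.mk f ≅ Arrow.mk (Y.cpx.d (pen n) (top n)))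
    {g : V ⟶ W} (eg : Arrow.mk g ≅ Arrow.mk (X.cpx.d (pen n) (top n))) :
    ∃ (A₁ B₁ : C) (ξ : Ext E B₁ A₁) (L : EndedComplex n A₁ B₁), Realizes s ξ L ∧
      (∀ i, P (L.cpx.X i)) ∧
      Nonempty (Arrow.mk (f ≫ g) ≅ Arrow.mk (L.cpx.d (pen n) (top n))) := by
  have := hs.hasFiniteBiproducts
  have := hasBinaryBiproducts_of_finite_biproducts C
  obtain ⟨A, B₂, ζ, Z, hZ, ⟨ez⟩⟩ := hs.deflation_comp f g ⟨Y', B', ε, Y, hY, ⟨ef⟩⟩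
    ⟨X', B, δ, X, hX, ⟨eg⟩⟩
  obtain ⟨a, b, hab⟩ := exists_eq_of_arrowIso ef
  obtain ⟨a', b', hab'⟩ := exists_eq_of_arrowIso eg
  obtain ⟨p, q, hpq⟩ := exists_eq_of_arrowIso ez
  let u : B ≅ B₂ := X.target.symm ≪≫ b'.symm ≪≫ q ≪≫ Z.target
  obtain ⟨Z', hZ'⟩ := exists_realizes s (pull E u.hom ζ)
  obtain ⟨F, hF⟩ := hs.exactRealization.lift _ _ Z Z' hZ hZ' (𝟙 A) u.inv (by
    rw [← pull_comp]; simp)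
  obtain ⟨G, hG⟩ := hs.exactRealization.lift _ _ Z' Z hZ' hZ (𝟙 A) u.hom (by simp)
  have hF' := hF.comp_proj
  have hG' := hG.comp_proj
  obtain ⟨D, hD, θ, γ, hγ⟩ := exists_push_eq_of_comp hs hn hP hext hX hY
    (Y.target.symm ≪≫ b.symm ≪≫ a') hZ'
    (a.inv ≫ p.hom ≫ F.f (pen n)) (by
      rw [Category.assoc, Category.assoc, hF']
      simp [EndedComplex.proj, hab, hab', hpq, u])
    (G.f (pen n) ≫ p.inv ≫ a.hom) (by
      have h1 : Z'.proj = G.f (pen n) ≫ Z.proj ≫ u.inv := by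
        rw [reassoc_of% hG', Iso.hom_inv_id, Category.comp_id]
      rw [h1]
      simp [EndedComplex.proj, hab, hab', hpq, u]) hPX
    (hP.iso Y.source (hPY _))
  obtain ⟨A₁, ξ, L, hL, hPL, ⟨eL⟩⟩ := exists_realizes_of_push_eq hP hs hn hext hZ
    (hP.iso (X.target ≪≫ u) (hPX _)) (hP.iso (a.symm ≪≫ p) (hPY _)) hD (pull E u.inv θ) γ
    (by rw [push_pull, hγ, ← pull_comp]; simp)
  exact ⟨A₁, B₂, ξ, L, hL, hPL, ⟨ez ≪≫ eL⟩⟩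

end Arrows

/-- An isomorphism of arrows in the ambient category, in the full subcategory. -/
theorem nonempty_arrowIso_of_hom {C : Type u} [Category.{v} C] {P : ObjectProperty C}
    {U V X Y : P.FullSubcategory} {f : U ⟶ V} {g : X ⟶ Y}
    (e : Arrow.mk f.hom ≅ Arrow.mk g.hom) : Nonempty (Arrow.mk f ≅ Arrow.mk g) :=
  ⟨Arrow.isoMk (P.isoMk (Arrow.leftFunc.mapIso e)) (P.isoMk (Arrow.rightFunc.mapIso e))
    (ObjectProperty.hom_ext _ e.hom.w)⟩

/-! ### Transfer of the structure to the full subcategory. -/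

section Restriction

variable {C : Type u} [Category.{v} C] [Preadditive C] {n : ℕ} {P : ObjectProperty C}

namespace EndedComplex

/-- A morphism of complexes in the ambient category, as a morphism in the full subcategory. -/
def ofAmbientHom {A B A' B' : P.FullSubcategory} {X : EndedComplex n A B}
    {Y : EndedComplex n A' B'} (f : X.toAmbient.cpx ⟶ Y.toAmbient.cpx) : X.cpx ⟶ Y.cpx where
  f i := ObjectProperty.homMk (f.f i)
  comm' i j _ := ObjectProperty.hom_ext _ (f.comm i j)

/-- A homotopy in the ambient category, as a homotopy in the full subcategory. -/
def ofAmbientHomotopy {A B A' B' : P.FullSubcategory} {X : EndedComplex n A B}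
    {Y : EndedComplex n A' B'} {f g : X.cpx ⟶ Y.cpx}
    (h : Homotopy ((P.ι.mapHomologicalComplex (shape n)).map f)
      ((P.ι.mapHomologicalComplex (shape n)).map g)) : Homotopy f g where
  hom i j := ObjectProperty.homMk (h.hom i j)
  zero i j hij := ObjectProperty.hom_ext _ (h.zero i j hij)
  comm i := ObjectProperty.hom_ext _ (h.comm i)

theorem isLift_ofAmbientHom {A B A' B' : P.FullSubcategory} {X : EndedComplex n A B}
    {Y : EndedComplex n A' B'} {f : X.toAmbient.cpx ⟶ Y.toAmbient.cpx} {a : A ⟶ A'} {c : B ⟶ B'}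
    (h : IsLift f a.hom c.hom) : IsLift (ofAmbientHom f) a c :=
  ⟨ObjectProperty.hom_ext _ h.1, ObjectProperty.hom_ext _ h.2⟩

theorem equivalent_toAmbient {A B : P.FullSubcategory} {X Y : EndedComplex n A B} :
    X.toAmbient.Equivalent Y.toAmbient ↔ X.Equivalent Y := by
  constructor
  · rintro ⟨e, h, h'⟩
    exact ⟨⟨ofAmbientHom e.hom, ofAmbientHom e.inv, ofAmbientHomotopy e.homotopyHomInvId,
      ofAmbientHomotopy e.homotopyInvHomId⟩, isLift_ofAmbientHom h, isLift_ofAmbientHom h'⟩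
  · rintro ⟨e, h, h'⟩
    exact ⟨P.ι.mapHomotopyEquiv e, ⟨congrArg (·.hom) h.1, congrArg (·.hom) h.2⟩,
      ⟨congrArg (·.hom) h'.1, congrArg (·.hom) h'.2⟩⟩

end EndedComplex

variable {E : Cᵒᵖ ⥤ C ⥤ AddCommGrpCat.{w}} {s : Correspondence n E}

/-- The chosen complex is immaterial: any two realizations are equivalent in `C`, and by fullness
such an equivalence already lives in `P`. -/
theorem realizes_restrictCorrespondence_iff (hext : IsNExtensionClosed s P)
    {A B : P.FullSubcategory} (δ : Ext (restrictBifunctor E P) B A) (X : EndedComplex n A B) :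
    Realizes (restrictCorrespondence s P hext) δ X ↔
      Realizes (E := E) s (A := A.obj) (B := B.obj) δ X.toAmbient := by
  have h := (hext A.property B.property δ).choose_spec
  have h' : Realizes (restrictCorrespondence s P hext) δ (EndedComplex.restrict _ h.2) := rfl
  constructor
  · intro hX
    exact h.1.of_equivalent (EndedComplex.equivalent_toAmbient.2 (h'.equivalent hX))
  · intro hX
    exact h'.of_equivalent (EndedComplex.equivalent_toAmbient.1 (h.1.equivalent hX))

/-- Fullness identifies the Hom sets, so exactness is only tested on fewer objects `T`. -/
theorem isExangle_of_toAmbient {A B : P.FullSubcategory}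
    {δ : Ext (restrictBifunctor E P) B A} {X : EndedComplex n A B}
    (h : IsExangle E (A := A.obj) (B := B.obj) X.toAmbient δ) :
    IsExangle (restrictBifunctor E P) X δ where
  push_inc := h.push_inc
  pull_proj := h.pull_proj
  exact_to T i j k hij hjk g := by
    refine Iff.trans ?_ ((h.exact_to T.obj i j k hij hjk g.hom).trans ?_)
    · exact ⟨fun h => congrArg (·.hom) h, fun h => ObjectProperty.hom_ext _ h⟩
    · exact ⟨fun ⟨l, hl⟩ => ⟨ObjectProperty.homMk l, ObjectProperty.hom_ext _ hl⟩,
        fun ⟨l, hl⟩ => ⟨l.hom, congrArg (·.hom) hl⟩⟩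
  exact_to_last T g := by
    refine (h.exact_to_last T.obj g.hom).trans ?_
    exact ⟨fun ⟨l, hl⟩ => ⟨ObjectProperty.homMk l, ObjectProperty.hom_ext _ hl⟩,
      fun ⟨l, hl⟩ => ⟨l.hom, congrArg (·.hom) hl⟩⟩
  exact_from T i j k hij hjk g := by
    refine Iff.trans ?_ ((h.exact_from T.obj i j k hij hjk g.hom).trans ?_)
    · exact ⟨fun h => congrArg (·.hom) h, fun h => ObjectProperty.hom_ext _ h⟩
    · exact ⟨fun ⟨l, hl⟩ => ⟨ObjectProperty.homMk l, ObjectProperty.hom_ext _ hl⟩,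
        fun ⟨l, hl⟩ => ⟨l.hom, congrArg (·.hom) hl⟩⟩
  exact_from_first T g := by
    refine (h.exact_from_first T.obj g.hom).trans ?_
    exact ⟨fun ⟨l, hl⟩ => ⟨ObjectProperty.homMk l, ObjectProperty.hom_ext _ hl⟩,
      fun ⟨l, hl⟩ => ⟨l.hom, congrArg (·.hom) hl⟩⟩

theorem isZero_obj {X : P.FullSubcategory} (hX : IsZero X) : IsZero X.obj := by
  rw [IsZero.iff_id_eq_zero] at hX ⊢
  exact congrArg (·.hom) hX

theorem isExactRealization_restrictCorrespondence (hs : IsExactRealization E s)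
    (hext : IsNExtensionClosed s P) :
    IsExactRealization (restrictBifunctor E P) (restrictCorrespondence s P hext) where
  lift δ ρ X Y hX hY a c h := by
    rw [realizes_restrictCorrespondence_iff] at hX hY
    obtain ⟨f, hf⟩ := hs.lift _ _ _ _ hX hY a.hom c.hom h
    exact ⟨EndedComplex.ofAmbientHom f, EndedComplex.isLift_ofAmbientHom hf⟩
  exangle δ X hX := by
    rw [realizes_restrictCorrespondence_iff] at hX
    exact isExangle_of_toAmbient (hs.exangle _ _ hX)
  zero_right X h h0 := by
    rw [realizes_restrictCorrespondence_iff]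
    exact hs.zero_right X.toAmbient (P.ι.map_isIso (X.cpx.d 0 (one n)))
      (fun i hi => isZero_obj (h0 i hi))
  zero_left X h h0 := by
    rw [realizes_restrictCorrespondence_iff]
    exact hs.zero_left X.toAmbient (P.ι.map_isIso (X.cpx.d (pen n) (top n)))
      (fun i hi => isZero_obj (h0 i hi))

theorem IsAdditiveSubcategory.hasFiniteBiproducts [HasFiniteBiproducts C]
    (hP : IsAdditiveSubcategory P) : HasFiniteBiproducts P.FullSubcategory := by
  have := hasBinaryBiproducts_of_finite_biproducts C
  obtain ⟨Z, hZ⟩ := HasZeroObject.zero (C := C)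
  have h0 : IsZero (⟨Z, hP.zero hZ⟩ : P.FullSubcategory) := by
    rw [IsZero.iff_id_eq_zero]
    exact ObjectProperty.hom_ext _ (hZ.eq_of_src _ _)
  have : HasZeroObject P.FullSubcategory := ⟨_, h0⟩
  have : HasBinaryBiproducts P.FullSubcategory := ⟨fun X Y => by
    let b : BinaryBicone X Y :=
      { pt := ⟨X.obj ⊞ Y.obj, hP.biprod X.property Y.property⟩
        fst := ObjectProperty.homMk biprod.fst
        snd := ObjectProperty.homMk biprod.snd
        inl := ObjectProperty.homMk biprod.inl
        inr := ObjectProperty.homMk biprod.inr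
        inl_fst := ObjectProperty.hom_ext _ biprod.inl_fst
        inl_snd := ObjectProperty.hom_ext _ biprod.inl_snd
        inr_fst := ObjectProperty.hom_ext _ biprod.inr_fst
        inr_snd := ObjectProperty.hom_ext _ biprod.inr_snd }
    exact ⟨⟨b, isBinaryBilimitOfTotal b (ObjectProperty.hom_ext _ biprod.total)⟩⟩⟩
  have : HasBinaryProducts P.FullSubcategory := inferInstance
  have : HasFiniteProducts P.FullSubcategory := hasFiniteProducts_of_has_binary_and_terminal
  exact HasFiniteBiproducts.of_hasFiniteProducts

/-- A product diagram in the ambient category is one in the full subcategory. -/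
theorem nonempty_isLimit_binaryFan {X Y Z : P.FullSubcategory} {p : Z ⟶ X} {q : Z ⟶ Y}
    (h : Nonempty (IsLimit (BinaryFan.mk p.hom q.hom))) :
    Nonempty (IsLimit (BinaryFan.mk p q)) := by
  obtain ⟨i, j, hip, hiq, hjp, hjq, ht⟩ := exists_of_isLimit_binaryFan h
  let b : BinaryBicone X Y :=
    { pt := Z, fst := p, snd := q
      inl := ObjectProperty.homMk i, inr := ObjectProperty.homMk j
      inl_fst := ObjectProperty.hom_ext _ hip
      inl_snd := ObjectProperty.hom_ext _ hiq
      inr_fst := ObjectProperty.hom_ext _ hjp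
      inr_snd := ObjectProperty.hom_ext _ hjq }
  exact ⟨(isBinaryBilimitOfTotal b (ObjectProperty.hom_ext _ ht)).isLimit⟩

/-- A coproduct diagram in the ambient category is one in the full subcategory. -/
theorem nonempty_isColimit_binaryCofan {X Y Z : P.FullSubcategory} {i : X ⟶ Z} {j : Y ⟶ Z}
    (h : Nonempty (IsColimit (BinaryCofan.mk i.hom j.hom))) :
    Nonempty (IsColimit (BinaryCofan.mk i j)) := by
  obtain ⟨p, q, hip, hiq, hjp, hjq, ht⟩ := exists_of_isColimit_binaryCofan h
  let b : BinaryBicone X Y :=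
    { pt := Z, inl := i, inr := j
      fst := ObjectProperty.homMk p, snd := ObjectProperty.homMk q
      inl_fst := ObjectProperty.hom_ext _ hip
      inl_snd := ObjectProperty.hom_ext _ hiq
      inr_fst := ObjectProperty.hom_ext _ hjp
      inr_snd := ObjectProperty.hom_ext _ hjq }
  exact ⟨(isBinaryBilimitOfTotal b (ObjectProperty.hom_ext _ ht)).isColimit⟩

/-- Mapping cone data in the ambient category, seen in the full subcategory. -/
def MappingConeData.ofAmbient {A B D : P.FullSubcategory} {X : EndedComplex n A B}
    {Y : EndedComplex n A D} {f : X.toAmbient.cpx ⟶ Y.toAmbient.cpx}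
    {M : EndedComplex n (X.cpx.X (one n)) D}
    (m : MappingConeData (X := X.toAmbient) (Y := Y.toAmbient) f M.toAmbient) :
    MappingConeData (EndedComplex.ofAmbientHom f) M where
  fst i j := ObjectProperty.homMk (m.fst i j)
  snd i := ObjectProperty.homMk (m.snd i)
  fst_first := ObjectProperty.hom_ext _ m.fst_first
  snd_first := ObjectProperty.hom_ext _ m.snd_first
  snd_last := ObjectProperty.hom_ext _ m.snd_last
  isProduct i j hij hi := nonempty_isLimit_binaryFan (m.isProduct i j hij hi)
  d_fst i j k hij hjk := ObjectProperty.hom_ext _ (m.d_fst i j k hij hjk)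
  d_snd i j hij := ObjectProperty.hom_ext _ (m.d_snd i j hij)

/-- Mapping cocone data in the ambient category, seen in the full subcategory. -/
def MappingCoconeData.ofAmbient {A A' B : P.FullSubcategory} {X : EndedComplex n A B}
    {Y : EndedComplex n A' B} {f : X.toAmbient.cpx ⟶ Y.toAmbient.cpx}
    {N : EndedComplex n A (Y.cpx.X (pen n))}
    (m : MappingCoconeData (X := X.toAmbient) (Y := Y.toAmbient) f N.toAmbient) :
    MappingCoconeData (EndedComplex.ofAmbientHom f) N where
  inl j := ObjectProperty.homMk (m.inl j)
  inr i j := ObjectProperty.homMk (m.inr i j)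
  inr_last := ObjectProperty.hom_ext _ m.inr_last
  inl_last := ObjectProperty.hom_ext _ m.inl_last
  inl_first := ObjectProperty.hom_ext _ m.inl_first
  isCoproduct i j hij hj := nonempty_isColimit_binaryCofan (m.isCoproduct i j hij hj)
  inr_d i j k hij hjk := ObjectProperty.hom_ext _ (m.inr_d i j k hij hjk)
  inl_d i j hij := ObjectProperty.hom_ext _ (m.inl_d i j hij)

/-- Good lifts are those of `C`, whose cones and cocones have terms in `P`. Only (EA1) needs new
realizing complexes. -/
theorem isNExangulated_restrictCorrespondence [IsIdempotentComplete C]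
    (hs : IsNExangulated E s) (hn : 1 ≤ n) (hP : IsAdditiveSubcategory P)
    (hext : IsNExtensionClosed s P) :
    IsNExangulated (restrictBifunctor E P) (restrictCorrespondence s P hext) := by
  have := hs.hasFiniteBiproducts
  have := hasBinaryBiproducts_of_finite_biproducts C
  have := hs.additive_right
  have := hs.additive_left
  have hterm : ∀ {A B : P.FullSubcategory} (X : EndedComplex n A B) (i : Fin (n + 2)),
      P (X.toAmbient.cpx.X i) := fun X i => (X.cpx.X i).property
  have hmap : ∀ {U V X Y : P.FullSubcategory} {f : U ⟶ V} {g : X ⟶ Y},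
      (Arrow.mk f ≅ Arrow.mk g) → (Arrow.mk f.hom ≅ Arrow.mk g.hom) :=
    fun e => P.ι.mapArrow.mapIso e
  exact
  { hasFiniteBiproducts := hP.hasFiniteBiproducts
    additive_right := fun B => ⟨fun {_ _ a a'} => (hs.additive_right B.obj).map_add⟩
    additive_left := fun A => ⟨fun {_ _ c c'} =>
      (hs.additive_left A.obj).map_add (f := c.unop.hom.op) (g := c'.unop.hom.op)⟩
    exactRealization := isExactRealization_restrictCorrespondence hs.exactRealization hext
    inflation_comp := by
      rintro U V W f g ⟨A, B, δ, X, hX, ⟨ef⟩⟩ ⟨A', B', ε, Y, hY, ⟨eg⟩⟩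
      rw [realizes_restrictCorrespondence_iff] at hX hY
      obtain ⟨A₁, B₁, ξ, L, hL, hPL, ⟨eL⟩⟩ := exists_realizes_of_inflation_comp hP hs hn hext
        hX (hterm X) hY (hterm Y) (hmap ef) (hmap eg)
      let A₂ : P.FullSubcategory := ⟨A₁, hP.iso L.source (hPL _)⟩
      let B₂ : P.FullSubcategory := ⟨B₁, hP.iso L.target (hPL _)⟩
      refine ⟨A₂, B₂, ξ, EndedComplex.restrict (A := A₂) (B := B₂) L hPL, ?_,
        nonempty_arrowIso_of_hom eL⟩
      exact (realizes_restrictCorrespondence_iff hext (A := A₂) (B := B₂) ξ _).2 hL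
    deflation_comp := by
      rintro U V W f g ⟨A, B, δ, X, hX, ⟨ef⟩⟩ ⟨A', B', ε, Y, hY, ⟨eg⟩⟩
      rw [realizes_restrictCorrespondence_iff] at hX hY
      -- The complex of the second deflation comes first here, since it contains the target of the
      -- composite.
      obtain ⟨A₁, B₁, ξ, L, hL, hPL, ⟨eL⟩⟩ := exists_realizes_of_deflation_comp hP hs hn hext
        hY (hterm Y) hX (hterm X) (hmap ef) (hmap eg)
      let A₂ : P.FullSubcategory := ⟨A₁, hP.iso L.source (hPL _)⟩
      let B₂ : P.FullSubcategory := ⟨B₁, hP.iso L.target (hPL _)⟩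
      refine ⟨A₂, B₂, ξ, EndedComplex.restrict (A := A₂) (B := B₂) L hPL, ?_,
        nonempty_arrowIso_of_hom eL⟩
      exact (realizes_restrictCorrespondence_iff hext (A := A₂) (B := B₂) ξ _).2 hL
    good_lift := by
      intro A B D ρ c X Y hX hY
      rw [realizes_restrictCorrespondence_iff] at hX hY
      obtain ⟨f, M, hf, ⟨m⟩, hM⟩ := hs.good_lift (A := A.obj) (B := B.obj) (D := D.obj)
        ρ c.hom X.toAmbient Y.toAmbient hX hY
      have hPM := m.prop hP (hterm X) (hterm Y)
      refine ⟨EndedComplex.ofAmbientHom f,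
        EndedComplex.restrict (A := X.cpx.X (one n)) (B := D) M hPM,
        EndedComplex.isLift_ofAmbientHom hf, ⟨MappingConeData.ofAmbient m⟩, ?_⟩
      rw [realizes_restrictCorrespondence_iff]
      exact hM
    good_lift_op := by
      intro A A' B δ a X Y hX hY
      rw [realizes_restrictCorrespondence_iff] at hX hY
      obtain ⟨f, N, hf, ⟨m⟩, hN⟩ := hs.good_lift_op (A := A.obj) (A' := A'.obj) (B := B.obj)
        δ a.hom X.toAmbient Y.toAmbient hX hY
      have hPN := m.prop hP (hterm X) (hterm Y)
      refine ⟨EndedComplex.ofAmbientHom f,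
        EndedComplex.restrict (A := A) (B := Y.cpx.X (pen n)) N hPN,
        EndedComplex.isLift_ofAmbientHom hf, ⟨MappingCoconeData.ofAmbient m⟩, ?_⟩
      rw [realizes_restrictCorrespondence_iff]
      exact hN }

end Restriction

end NExangulated

theorem theorem3p2 {C : Type u} [Category.{v} C] [Preadditive C] [HasFiniteBiproducts C]
    (hKS : NExangulated.IsKrullSchmidt C)
    (n : ℕ) (hn : 1 ≤ n)
    (E : Cᵒᵖ ⥤ C ⥤ AddCommGrpCat.{w})
    (s : NExangulated.Correspondence n E) (hs : NExangulated.IsNExangulated E s)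
    (P : ObjectProperty C) (hP : NExangulated.IsAdditiveSubcategory P)
    (hext : NExangulated.IsNExtensionClosed s P) :
    (∀ (A B : P.FullSubcategory)
        (δ : NExangulated.Ext (NExangulated.restrictBifunctor E P) B A)
        (X : NExangulated.EndedComplex n A B),
        NExangulated.Realizes (NExangulated.restrictCorrespondence s P hext) δ X ↔
          NExangulated.Realizes (E := E) s (A := A.obj) (B := B.obj) δ X.toAmbient) ∧
      NExangulated.IsNExangulated (NExangulated.restrictBifunctor E P)
        (NExangulated.restrictCorrespondence s P hext) := by
  have := hKS.isIdempotentComplete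
  exact ⟨fun A B δ X => NExangulated.realizes_restrictCorrespondence_iff hext δ X,
    NExangulated.isNExangulated_restrictCorrespondence hs hn hP hext⟩
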